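/- **Bounded degree lemma.** Fix integers $1\le j\le k-1$, and write $[n]=\{1,\dots,n\}$ and $p_{k,j}=p_{k,j}(n)=\frac{(k-j)!}{\binom kj-1}\,n^{j-k}$. *Search algorithms.* Let $H$ be a $k$-uniform hypergraph on $[n]$, let $\sigma$ be a linear ordering of the $k$-subsets of $[n]$, and let $\tau$ and $\rho$ be linear orderings of the $j$-subsets of $[n]$. Each $j$-set is neutral, active or explored; $j$-sets that are not neutral are called discovered. The active $j$-sets are kept on a stack. Initially all $j$-sets are neutral, the stack is empty and no $k$-set has been queried. As long as not all $j$-sets are explored, repeat the following. * If the stack is empty, the $\tau$-smallest neutral $j$-set becomes active and is put on the stack. * Otherwise let $J$ be the top element of the stack (Algorithms 1 and 2) or its bottom element (BFS1 and BFS2). Consider the unqueried $k$-sets $K\supseteq J$ which contain at least one neutral $j$-set (Algorithm 1 and BFS1), respectively in which all $j$-subsets other than $J$ are neutral (Algorithm 2 and BFS2). If there is such a $K$, query the $\sigma$-smallest one; if $K\in E(H)$, then all neutral $j$-subsets of $K$ become active and are added to the top of the stack in ascending order with respect to $\rho$. If there is no such $K$, remove $J$ from the stack and mark it explored. When all $j$-sets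 are explored, query all remaining $k$-sets in the order $\sigma$. For real $t\ge 0$, let $G_j(t)$ be the $j$-uniform hypergraph on $[n]$ whose edges are the $j$-sets discovered by time $t$, that is, at some moment at which at most $t$ queries have been made. *Statement.* There are constants $C>0$ and $\varepsilon_0>0$, depending only on $k$ and $j$, such that the following holds. Let $\delta\in(0,1)$ be a constant and let $\varepsilon=\varepsilon(n)$ and $\alpha=\alpha(n)$ satisfy $$0<\varepsilon\le\varepsilon_0,\qquad \alpha\le\frac{\varepsilon}{32\,k!\,2^j\,C},\qquad \frac{\alpha}{n^{\delta-1}+n^{-j/3}}\to\infty\quad (n\to\infty).$$ Then for all sufficiently large $n$ the number $p=(1+\varepsilon)p_{k,j}$ lies in $[0,1]$, and the following is true for each of Algorithm 1, Algorithm 2, BFS1 and BFS2, for every ordering $\sigma$, and for every rule $\tau\mapsto\rho$ that determines the ordering $\rho$ (for example $\rho=\tau$, or a fixed $\rho$). If $H=H^k(n,p)$ is the random $k$-uniform hypergraph on $[n]$ in which each $k$-set is an edge independently with probability $p$, and $\tau$ is a uniformly random ordering of the $j$-sets, independent of $H$, then with probability at least $1-\exp(-n^{\delta/2})$, for every $0\le\ell\le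 j-1$ every $\ell$-subset of $[n]$ is contained in at most $C\alpha n^{j-\ell}$ edges of $G_j(\alpha n^k)$. -/

import Mathlib

open MeasureTheory ProbabilityTheory

/-- A linear ordering of a finite type `α`, given by the rank of each element. -/
abbrev Ranking (α : Type*) [Fintype α] : Type _ := α ≃ Fin (Fintype.card α)

/-- All events about a random ordering of a finite type are measurable. -/
instance Ranking.instMeasurableSpace (α : Type*) [Fintype α] : MeasurableSpace (Ranking α) := ⊤

/-- The smallest element of the finite set `A` in the ordering `σ` (`none` if `A` is empty). -/
def Ranking.first {α : Type*} [Fintype α] (σ : Ranking α) (A : Finset α) : Option α :=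
  if h : (A.map σ.toEmbedding).Nonempty then
    some (σ.symm ((A.map σ.toEmbedding).min' h))
  else none

/-- The elements of `A` listed in descending order with respect to `σ`. -/
def Ranking.descending {α : Type*} [Fintype α] (σ : Ranking α) (A : Finset α) : List α :=
  ((A.map σ.toEmbedding).sort (fun a b => b ≤ a)).map σ.symm

/-- The three types of vertices during the search. A vertex which is not neutral is called
discovered. -/
inductive VertexStatus : Type
  | neutral
  | active
  | explored
  deriving DecidableEq

/-- The four search algorithms. -/
inductive SearchAlg : Type
  | algorithm1
  | algorithm2
  | bfs1
  | bfs2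

/-- The vertex of the (nonempty) stack from which we currently explore: the top vertex for the
depth-first searches, the bottom vertex for the breadth-first searches. Stacks are lists whose head
is the top of the stack. -/
def SearchAlg.current {V : Type*} : SearchAlg → List V → Option V
  | .algorithm1, S => S.head?
  | .algorithm2, S => S.head?
  | .bfs1, S => S.getLast?
  | .bfs2, S => S.getLast?

/-- The condition, besides `x ∈ e`, under which an unqueried edge with vertex set `e` may be queried
from `x`: it contains a neutral vertex (Algorithm 1 and BFS1), or all its vertices other than `x` are
neutral (Algorithm 2 and BFS2). -/
def SearchAlg.MayQuery {V : Type*} (status : V → VertexStatus) (x : V) (e : Finset V) :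
    SearchAlg → Prop
  | .algorithm1 => ∃ v ∈ e, status v = .neutral
  | .algorithm2 => ∀ v ∈ e, v ≠ x → status v = .neutral
  | .bfs1 => ∃ v ∈ e, status v = .neutral
  | .bfs2 => ∀ v ∈ e, v ≠ x → status v = .neutral

/-- The state of a search in a hypergraph with vertices `V` and (labels of) edges `E`. -/
structure SearchState (V E : Type*) where
  status : V → VertexStatus
  stack : List V
  queried : Finset E

/-- At the beginning all vertices are neutral, the stack is empty and nothing has been queried. -/
def SearchState.init (V E : Type*) : SearchState V E where
  status := fun _ => .neutral
  stack := []
  queried := ∅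

open Classical in
/-- One step of the search algorithm `alg` in the hypergraph with vertex set `V`, whose edge labelled
`e : E` has vertex set `inc e`, with `H` the set of edges which are present.

* If the stack is empty and there is a neutral vertex, the `τ`-smallest neutral vertex becomes active
  and is put on the stack; if there is no neutral vertex, the `σ`-smallest unqueried edge is queried
  (if there is one).
* If the stack is nonempty and `x` is its current vertex, the `σ`-smallest unqueried edge containing
  `x` that may be queried is queried; if it is present, all its neutral vertices become active and
  are added to the top of the stack in ascending order with respect to `ρ`. If there is no such edge,
  `x` is removed from the stack and becomes explored. -/
noncomputable def SearchAlg.step {V E : Type*} [Fintype V] [Fintype E] (alg : SearchAlg)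
    (inc : E → Finset V) (σ : Ranking E) (τ ρ : Ranking V) (H : Set E) (s : SearchState V E) :
    SearchState V E :=
  match alg.current s.stack with
  | none =>
    match τ.first {v | s.status v = .neutral} with
    | some x =>
      { status := Function.update s.status x .active
        stack := [x]
        queried := s.queried }
    | none =>
      match σ.first {e | e ∉ s.queried} with
      | some e =>
        { status := s.status
          stack := s.stack
          queried := insert e s.queried }
      | none => s
  | some x =>
    match σ.first {e | e ∉ s.queried ∧ x ∈ inc e ∧ alg.MayQuery s.status x (inc e)} with
    | some e =>
      if e ∈ H then
        { status := fun v => if v ∈ inc e ∧ s.status v = .neutral then .active else s.status v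
          stack := ρ.descending {v ∈ inc e | s.status v = .neutral} ++ s.stack
          queried := insert e s.queried }
      else
        { status := s.status
          stack := s.stack
          queried := insert e s.queried }
    | none =>
      { status := Function.update s.status x .explored
        stack := s.stack.erase x
        queried := s.queried }

/-- The state of the search after `i` steps (not every step makes a query). -/
noncomputable def SearchAlg.run {V E : Type*} [Fintype V] [Fintype E] (alg : SearchAlg)
    (inc : E → Finset V) (σ : Ranking E) (τ ρ : Ranking V) (H : Set E) (i : ℕ) :
    SearchState V E :=
  (alg.step inc σ τ ρ H)^[i] (SearchState.init V E)

/-- The set of vertices discovered by time `t`, i.e. at some moment at which at most `t` queries have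
been made. -/
def SearchAlg.discovered {V E : Type*} [Fintype V] [Fintype E] (alg : SearchAlg)
    (inc : E → Finset V) (σ : Ranking E) (τ ρ : Ranking V) (H : Set E) (t : ℝ) : Set V :=
  {v | ∃ i : ℕ, ((alg.run inc σ τ ρ H i).queried.card : ℝ) ≤ t ∧
    (alg.run inc σ τ ρ H i).status v ≠ .neutral}

/-- The `r`-element subsets of the vertex set `[n]`. -/
abbrev SetOfSize (n r : ℕ) : Type := {s : Finset (Fin n) // s.card = r}

/-- The auxiliary hypergraph on `j`-sets: the edge given by a `k`-set `K` consists of all `j`-element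
subsets of `K`. -/
def jSubsets (n k j : ℕ) (K : SetOfSize n k) : Finset (SetOfSize n j) :=
  {J | J.1 ⊆ K.1}

/-- The threshold `p_{k,j}(n) = (k-j)! / (binom(k,j) - 1) * n^(j-k)`. -/
noncomputable def pThreshold (k j n : ℕ) : ℝ :=
  ((k - j).factorial : ℝ) / ((k.choose j : ℝ) - 1) * (n : ℝ) ^ ((j : ℝ) - (k : ℝ))

/-- The edges of `G_j(t)`, i.e. the set of `j`-sets discovered by time `t` by the algorithm `alg`
run on the `k`-uniform hypergraph on `[n]` with edge set `H`. -/
def discoveredJSets {n k j : ℕ} (alg : SearchAlg) (σ : Ranking (SetOfSize n k))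
    (τ ρ : Ranking (SetOfSize n j)) (H : Set (SetOfSize n k)) (t : ℝ) : Set (SetOfSize n j) :=
  alg.discovered (jSubsets n k j) σ τ ρ H t

/-- The degree of `L ⊆ [n]` in the `j`-uniform hypergraph with edge set `G`. -/
noncomputable def setDegree {n j : ℕ} (G : Set (SetOfSize n j)) (L : Finset (Fin n)) : ℕ :=
  {J ∈ G | L ⊆ J.1}.ncard

/-- The joint law of the ordering `τ` of the `j`-sets and of the edge set of `H^k(n,p)`: `τ` is
uniformly random, and independently every `k`-set is an edge with probability `p` independently of
the others. -/
noncomputable def searchLaw (n k j : ℕ) (p : unitInterval) :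
    Measure (Ranking (SetOfSize n j) × Set (SetOfSize n k)) :=
  (uniformOn (Set.univ : Set (Ranking (SetOfSize n j)))).prod
    (setBernoulli (Set.univ : Set (SetOfSize n k)) p)

/-!
The search runs in the auxiliary hypergraph on the `j`-sets of `[n]`, and the degree of `L` at a
moment is the number of discovered `j`-sets containing `L`. There are constants `c₀ ≤ c₁ ≤ ⋯` such
that, with the required probability, all sets `L` with `ℓ < j` elements have degree at most
`c_ℓ α n ^ (j - ℓ)` as long as at most `α n ^ k` queries have been made. Randomness enters through two
estimates only; everything else is deterministic (`SearchAlg.degreeAt_le`).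

*Answers.* The queries form a deterministic adaptive procedure exposing independent edges. For every
predicate on states, a supermartingale argument, carried out as an induction on the number of steps
(`IsAdaptiveQuery.real_exists_le`), shows that at all times at once the number of edges found by the
queries with this predicate is at most `α n` plus `1 + slack` times its mean, up to probability
`exp (-slack * α n)`.

*Starting vertices.* When a `j`-set starts a component, all `j`-sets of smaller rank in `τ` are
already discovered. So the starting `j`-sets lie among the first `O(α n ^ j)` elements of `τ`, and it
suffices that a random ordering has few `j`-sets containing `L` in this initial segment, which no
longer refers to the search (`uniformOn_real_card_filter_le`).

For the deterministic part, suppose the degree bounds hold at some moment. Then for an explored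
`j`-set `J` a constant proportion of the `k`-sets containing `J` contain no other discovered `j`-set.
All these have been queried, and they are different for different `J`; hence only `O(α n ^ j)` `j`-sets
are explored, and the same holds for the starting ones
(`SearchAlg.card_exploredAt_le`). Together with the number of edges found this bounds the total number
of discovered `j`-sets at the next moment, which is the case `ℓ = 0`
(`SearchAlg.degreeAt_empty_le`). For nonempty `L` (`SearchAlg.degreeAt_le_of_ssubset`), a `j`-set
containing `L` is a starting one, or it is discovered from a `j`-set not containing `L`, and the
number of such queries is controlled by the degrees of the proper subsets of `L`
(`sum_card_supersets_union_le`), or it is discovered from a `j`-set containing `L`. This last process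
is subcritical: a `k`-set offers at most `k.choose j - 2` new `j`-sets containing `L`, one fewer
than it offers in total, so that the last contribution is at most a fixed proportion, below one, of
the degree of `L` itself and can be absorbed.
-/

/-! ### Adaptive queries to a binomial random set -/

section BinomialRandomSet

variable {E : Type*} [Fintype E]

/-- An event which does not depend on whether `e` is present is independent of the presence
of `e`. -/
theorem setBernoulli_real_inter_mem (p : unitInterval) (e : E) (A : Set (Set E))
    (hA : ∀ H, insert e H ∈ A ↔ H \ {e} ∈ A) :
    (setBernoulli (Set.univ : Set E) p).real (A ∩ {H | e ∈ H}) =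
        p * (setBernoulli (Set.univ : Set E) p).real A ∧
    (setBernoulli (Set.univ : Set E) p).real (A ∩ {H | e ∉ H}) =
        (1 - p) * (setBernoulli (Set.univ : Set E) p).real A := by
  classical
  have hfin : ∀ B : Set (Set E), (setBernoulli (Set.univ : Set E) p).real B =
      ∑ H ∈ B.toFinset, (p : ℝ) ^ H.ncard * (1 - p : ℝ) ^ (Hᶜ).ncard := by
    intro B
    rw [← Set.coe_toFinset B, ← sum_measureReal_singleton]
    refine Finset.sum_congr (by simp) fun H _ => ?_
    rw [setBernoulli_real_singleton p (Set.subset_univ H) Set.finite_univ, Set.compl_eq_univ_sdiff]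
  have hsplit : (setBernoulli (Set.univ : Set E) p).real A =
      (setBernoulli (Set.univ : Set E) p).real (A ∩ {H | e ∈ H}) +
      (setBernoulli (Set.univ : Set E) p).real (A ∩ {H | e ∉ H}) :=
    (measureReal_inter_add_sdiff (s := A)
      (MeasurableSet.of_discrete (s := {H : Set E | e ∈ H}))).symm
  have hbal : (setBernoulli (Set.univ : Set E) p).real (A ∩ {H | e ∈ H}) * (1 - p) =
      (setBernoulli (Set.univ : Set E) p).real (A ∩ {H | e ∉ H}) * p := by
    rw [hfin, hfin, Finset.sum_mul, Finset.sum_mul]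
    refine Finset.sum_bij' (fun H _ => H \ {e}) (fun H _ => insert e H) ?_ ?_ ?_ ?_ ?_
    · intro H hH
      simp only [Set.mem_toFinset, Set.mem_inter_iff, Set.mem_ofPred_eq] at hH ⊢
      refine ⟨(hA H).1 ?_, by simp⟩
      rw [Set.insert_eq_of_mem hH.2]; exact hH.1
    · intro H hH
      simp only [Set.mem_toFinset, Set.mem_inter_iff, Set.mem_ofPred_eq] at hH ⊢
      refine ⟨(hA H).2 ?_, by simp⟩
      rw [Set.sdiff_singleton_eq_self hH.2]; exact hH.1
    · intro H hH
      simp only [Set.mem_toFinset, Set.mem_inter_iff, Set.mem_ofPred_eq] at hH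
      simp [Set.insert_eq_of_mem hH.2]
    · intro H hH
      simp only [Set.mem_toFinset, Set.mem_inter_iff, Set.mem_ofPred_eq] at hH
      simp [Set.sdiff_singleton_eq_self hH.2]
    · intro H hH
      simp only [Set.mem_toFinset, Set.mem_inter_iff, Set.mem_ofPred_eq] at hH
      have h1 : H.ncard = (H \ {e}).ncard + 1 :=
        (Set.ncard_sdiff_singleton_add_one hH.2).symm
      have h2 : ((H \ {e})ᶜ).ncard = (Hᶜ).ncard + 1 := by
        rw [show (H \ {e})ᶜ = insert e Hᶜ by ext; simp [imp_iff_not_or, or_comm],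
          Set.ncard_insert_of_notMem (by simpa using hH.2)]
      rw [h1, h2]
      ring
  rw [hsplit]
  constructor <;> linarith

/-- If the event `G` entails `A` when `e` is present and `B` when `e` is absent, where neither `A`
nor `B` depends on the presence of `e`, then its probability is at most the corresponding
mixture. -/
theorem setBernoulli_real_le_mixture (p : unitInterval) (e : E) (G A B : Set (Set E))
    (hA : ∀ H, insert e H ∈ A ↔ H \ {e} ∈ A) (hB : ∀ H, insert e H ∈ B ↔ H \ {e} ∈ B)
    (hGA : ∀ H ∈ G, e ∈ H → H ∈ A) (hGB : ∀ H ∈ G, e ∉ H → H ∈ B) :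
    (setBernoulli (Set.univ : Set E) p).real G ≤
      p * (setBernoulli (Set.univ : Set E) p).real A +
      (1 - p) * (setBernoulli (Set.univ : Set E) p).real B := by
  rw [← (setBernoulli_real_inter_mem p e A hA).1, ← (setBernoulli_real_inter_mem p e B hB).2]
  refine le_trans (measureReal_mono ?_) (measureReal_union_le _ _)
  intro H hH
  by_cases he : e ∈ H
  · exact Or.inl ⟨hGA H hH he, he⟩
  · exact Or.inr ⟨hGB H hH he, he⟩

end BinomialRandomSet

section AdaptiveQueries

variable {S E : Type*}

/-- A deterministic procedure with states in `S` which explores an unknown set `H` of elements of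
`E`. In state `s` it asks whether `query s` belongs to `H` (if `query s` is `none` it makes a step
without a question), and its next state depends on `H` only through the answer. The set `used s`
records the elements about which no question is asked any more. -/
structure IsAdaptiveQuery (step : Set E → S → S) (query : S → Option E)
    (used : S → Finset E) : Prop where
  fresh : ∀ s e, query s = some e → e ∉ used s
  used_mono : ∀ H s, used s ⊆ used (step H s)
  mem_used : ∀ H s e, query s = some e → e ∈ used (step H s)
  step_congr : ∀ H H' s, (∀ e, query s = some e → (e ∈ H ↔ e ∈ H')) → step H s = step H' s

variable (step : Set E → S → S) (query : S → Option E)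

open Classical in
/-- The number of queries that are made in the first `m` steps from `s`, counting only those made
in a state belonging to `P`. -/
noncomputable def trials (P : Set S) (H : Set E) (s : S) (m : ℕ) : ℕ :=
  ∑ r ∈ Finset.range m,
    if (step H)^[r] s ∈ P ∧ ∃ e, query ((step H)^[r] s) = some e then 1 else 0

open Classical in
/-- The number of queries counted by `trials` that are answered positively. -/
noncomputable def hits (P : Set S) (H : Set E) (s : S) (m : ℕ) : ℕ :=
  ∑ r ∈ Finset.range m,
    if (step H)^[r] s ∈ P ∧ ∃ e, query ((step H)^[r] s) = some e ∧ e ∈ H then 1 else 0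

variable {step query}

open Classical in
theorem trials_succ (P : Set S) (H : Set E) (s : S) (m : ℕ) :
    trials step query P H s (m + 1) =
      trials step query P H (step H s) m + if s ∈ P ∧ ∃ e, query s = some e then 1 else 0 := by
  rw [trials, Finset.sum_range_succ']
  rfl

open Classical in
theorem hits_succ (P : Set S) (H : Set E) (s : S) (m : ℕ) :
    hits step query P H s (m + 1) =
      hits step query P H (step H s) m +
        if s ∈ P ∧ ∃ e, query s = some e ∧ e ∈ H then 1 else 0 := by
  rw [hits, Finset.sum_range_succ']
  rfl

theorem hits_le_succ (P : Set S) (H : Set E) (s : S) (m : ℕ) :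
    hits step query P H s m ≤ hits step query P H s (m + 1) := by
  rw [hits, hits, Finset.sum_range_succ]
  exact Nat.le_add_right _ _

theorem hits_succ_of_mem {P : Set S} {H : Set E} {s : S} {m : ℕ} {e : E}
    (hP : (step H)^[m] s ∈ P) (he : query ((step H)^[m] s) = some e) (heH : e ∈ H) :
    hits step query P H s (m + 1) = hits step query P H s m + 1 := by
  rw [hits, hits, Finset.sum_range_succ, if_pos ⟨hP, e, he, heH⟩]

variable {used : S → Finset E}

/-- The future of the procedure does not depend on the elements it has already used. -/
theorem IsAdaptiveQuery.future_congr (h : IsAdaptiveQuery step query used) (P : Set S)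
    {H H' : Set E} (m : ℕ) : ∀ s : S, (∀ e, e ∉ used s → (e ∈ H ↔ e ∈ H')) →
      trials step query P H s m = trials step query P H' s m ∧
      hits step query P H s m = hits step query P H' s m := by
  induction m with
  | zero => intro s _; simp [trials, hits]
  | succ m ih =>
    intro s hs
    have hq : ∀ e, query s = some e → (e ∈ H ↔ e ∈ H') := fun e he => hs e (h.fresh s e he)
    have hstep := h.step_congr H H' s hq
    have := ih (step H s) fun e he => hs e fun he' => he (h.used_mono H s he')
    rw [trials_succ, trials_succ, hits_succ, hits_succ, ← hstep, this.1, this.2]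
    refine ⟨rfl, ?_⟩
    congr 2
    simp only [eq_iff_iff]
    refine and_congr_right fun _ => exists_congr fun e => and_congr_right fun he => hq e he

/-- No question is asked twice, so the number of queries is at most the number of elements among
which they are chosen. -/
theorem IsAdaptiveQuery.trials_le_card (h : IsAdaptiveQuery step query used)
    (P : Set S) (H : Set E) (s : S) (m : ℕ) (B : Finset E)
    (hB : ∀ r < m, ∀ e, (step H)^[r] s ∈ P → query ((step H)^[r] s) = some e → e ∈ B) :
    trials step query P H s m ≤ B.card := by
  classical
  suffices ∀ i ≤ m, trials step query P H s i ≤ (B ∩ used ((step H)^[i] s)).card from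
    (this m le_rfl).trans (Finset.card_le_card Finset.inter_subset_left)
  intro i
  induction i with
  | zero => intro _; simp [trials]
  | succ i ih =>
    intro hi
    have ih := ih (by omega)
    have hmono : B ∩ used ((step H)^[i] s) ⊆ B ∩ used ((step H)^[i + 1] s) := by
      rw [Function.iterate_succ_apply']
      exact Finset.inter_subset_inter_left (h.used_mono H _)
    rw [trials, Finset.sum_range_succ, ← trials]
    split_ifs with hP
    · obtain ⟨hP, e, he⟩ := hP
      refine (Nat.succ_le_succ ih).trans (Finset.card_lt_card
        (Finset.ssubset_iff_of_subset hmono |>.2 ⟨e, ?_, ?_⟩))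
      · rw [Function.iterate_succ_apply']
        exact Finset.mem_inter.2 ⟨hB i (by omega) e hP he, h.mem_used H _ e he⟩
      · exact fun he' => h.fresh _ e he (Finset.mem_inter.1 he').2
    · exact ih.trans (Finset.card_le_card hmono)

/-- A maximal inequality for adaptive queries to a binomial random set: it is the one for the
exponential supermartingale `exp (θ * hits - c * trials)`. It is proved by induction on the
number of steps, conditioning on the answer to the first query. -/
theorem IsAdaptiveQuery.real_exists_le [Fintype E] (h : IsAdaptiveQuery step query used)
    (p : unitInterval) (P : Set S) (θ c : ℝ) (hc : 1 + p * (Real.exp θ - 1) ≤ Real.exp c) (i : ℕ) :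
    ∀ (s : S) (a : ℝ), (setBernoulli (Set.univ : Set E) p).real
      {H | ∃ m ≤ i, a ≤ θ * hits step query P H s m - c * trials step query P H s m} ≤
        Real.exp (-a) := by
  classical
  induction i with
  | zero =>
    intro s a
    by_cases ha : a ≤ 0
    · exact measureReal_le_one.trans (Real.one_le_exp (by linarith))
    · simp [hits, trials, ha, Real.exp_nonneg]
  | succ i ih =>
    intro s a
    by_cases ha : a ≤ 0
    · exact measureReal_le_one.trans (Real.one_le_exp (by linarith))
    have key : ∀ H : Set E,
        (∃ m ≤ i + 1, a ≤ θ * hits step query P H s m - c * trials step query P H s m) →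
        ∃ m ≤ i, a - (θ * (if s ∈ P ∧ ∃ e, query s = some e ∧ e ∈ H then 1 else 0) -
            c * (if s ∈ P ∧ ∃ e, query s = some e then 1 else 0)) ≤
          θ * hits step query P H (step H s) m - c * trials step query P H (step H s) m := by
      rintro H ⟨m, hm, hma⟩
      cases m with
      | zero => simp [hits, trials] at hma; exact absurd hma ha
      | succ m =>
        refine ⟨m, by omega, ?_⟩
        rw [hits_succ, trials_succ] at hma
        push_cast at hma
        linarith
    have hstep0 : ∀ e, query s = some e → ∀ H H' : Set E, (e ∈ H ↔ e ∈ H') →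
        step H s = step H' s := by
      intro e he H H' hH
      refine h.step_congr H H' s fun e' he' => ?_
      have : e = e' := by simpa [he] using he'
      exact this ▸ hH
    by_cases hP : s ∈ P ∧ ∃ e, query s = some e
    · obtain ⟨hsP, e, he⟩ := hP
      -- the states after a positive and after a negative answer
      set s₁ := step {e} s with hs₁
      set s₀ := step ∅ s with hs₀
      have hinv : ∀ (H₀ : Set E) (b : ℝ) (H : Set E),
          insert e H ∈ {H | ∃ m ≤ i, b ≤ θ * hits step query P H (step H₀ s) m -
              c * trials step query P H (step H₀ s) m} ↔
          H \ {e} ∈ {H | ∃ m ≤ i, b ≤ θ * hits step query P H (step H₀ s) m -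
              c * trials step query P H (step H₀ s) m} := by
        intro H₀ b H
        refine exists_congr fun m => and_congr_right fun _ => ?_
        have := h.future_congr P (H := insert e H) (H' := H \ {e}) m (step H₀ s) (by
          intro e' he'
          have : e' ≠ e := fun h' => he' (h' ▸ h.mem_used H₀ s e he)
          simp [this])
        rw [this.1, this.2]
      refine (setBernoulli_real_le_mixture p e _ _ _ (hinv {e} (a - (θ - c))) (hinv ∅ (a + c))
        ?_ ?_).trans ?_
      · intro H hH heH
        obtain ⟨m, hm, hma⟩ := key H hH
        refine ⟨m, hm, ?_⟩
        rw [← hstep0 e he H {e} (by simp [heH])]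
        simpa [hsP, he, heH] using hma
      · intro H hH heH
        obtain ⟨m, hm, hma⟩ := key H hH
        refine ⟨m, hm, ?_⟩
        rw [← hstep0 e he H ∅ (by simp [heH])]
        simpa [hsP, he, heH] using hma
      · have h1 := mul_le_mul_of_nonneg_left (ih s₁ (a - (θ - c))) p.2.1
        have h0 := mul_le_mul_of_nonneg_left (ih s₀ (a + c)) (sub_nonneg.2 p.2.2)
        refine (add_le_add h1 h0).trans ?_
        have e1 : Real.exp (-(a - (θ - c))) = Real.exp (-a) * Real.exp (-c) * Real.exp θ := by
          rw [← Real.exp_add, ← Real.exp_add]; ring_nf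
        have e2 : Real.exp (-(a + c)) = Real.exp (-a) * Real.exp (-c) := by
          rw [← Real.exp_add]; ring_nf
        rw [e1, e2]
        have e3 : Real.exp (-c) * Real.exp c = 1 := by rw [← Real.exp_add]; simp
        calc _ = Real.exp (-a) * (Real.exp (-c) * (1 + p * (Real.exp θ - 1))) := by ring
          _ ≤ Real.exp (-a) * (Real.exp (-c) * Real.exp c) := by gcongr
          _ = Real.exp (-a) := by rw [e3, mul_one]
    · have hgain : ∀ H : Set E, ¬ (s ∈ P ∧ ∃ e, query s = some e ∧ e ∈ H) :=
        fun H hH => hP ⟨hH.1, hH.2.imp fun _ => And.left⟩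
      by_cases hq : ∃ e, query s = some e
      · obtain ⟨e, he⟩ := hq
        have hinv : ∀ (H₀ : Set E) (b : ℝ) (H : Set E),
            insert e H ∈ {H | ∃ m ≤ i, b ≤ θ * hits step query P H (step H₀ s) m -
                c * trials step query P H (step H₀ s) m} ↔
            H \ {e} ∈ {H | ∃ m ≤ i, b ≤ θ * hits step query P H (step H₀ s) m -
                c * trials step query P H (step H₀ s) m} := by
          intro H₀ b H
          refine exists_congr fun m => and_congr_right fun _ => ?_
          have := h.future_congr P (H := insert e H) (H' := H \ {e}) m (step H₀ s) (by
            intro e' he'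
            have : e' ≠ e := fun h' => he' (h' ▸ h.mem_used H₀ s e he)
            simp [this])
          rw [this.1, this.2]
        refine (setBernoulli_real_le_mixture p e _ _ _ (hinv {e} a) (hinv ∅ a)
          ?_ ?_).trans ?_
        · intro H hH heH
          obtain ⟨m, hm, hma⟩ := key H hH
          refine ⟨m, hm, ?_⟩
          rw [← hstep0 e he H {e} (by simp [heH])]
          simpa [hP, hgain H] using hma
        · intro H hH heH
          obtain ⟨m, hm, hma⟩ := key H hH
          refine ⟨m, hm, ?_⟩
          rw [← hstep0 e he H ∅ (by simp [heH])]
          simpa [hP, hgain H] using hma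
        · have h1 := mul_le_mul_of_nonneg_left (ih (step {e} s) a) p.2.1
          have h0 := mul_le_mul_of_nonneg_left (ih (step ∅ s) a) (sub_nonneg.2 p.2.2)
          linarith
      · refine (measureReal_mono ?_).trans (ih (step ∅ s) a)
        intro H hH
        obtain ⟨m, hm, hma⟩ := key H hH
        refine ⟨m, hm, ?_⟩
        rw [← h.step_congr H ∅ s fun e he => absurd ⟨e, he⟩ hq]
        simpa [hP, hgain H] using hma

/-- With probability at least `1 - exp (-a)`, at all times at once the number of positive answers
exceeds `(exp θ - 1) / θ` times its mean by less than `a / θ`. -/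
theorem IsAdaptiveQuery.real_exists_le' [Fintype E] (h : IsAdaptiveQuery step query used)
    (p : unitInterval) (P : Set S) (θ : ℝ) (s : S) (a : ℝ) :
    (setBernoulli (Set.univ : Set E) p).real
      {H | ∃ m, a ≤ θ * hits step query P H s m -
        p * (Real.exp θ - 1) * trials step query P H s m} ≤ Real.exp (-a) := by
  classical
  have hc : 1 + p * (Real.exp θ - 1) ≤ Real.exp (p * (Real.exp θ - 1)) := by
    rw [add_comm]; exact Real.add_one_le_exp _
  -- there are finitely many `H`, so one bound on the number of steps suffices for all of them
  let f : Set E → ℕ := fun H =>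
    if hH : ∃ m, a ≤ θ * hits step query P H s m -
      p * (Real.exp θ - 1) * trials step query P H s m then Nat.find hH else 0
  refine (measureReal_mono ?_).trans
    (h.real_exists_le p P θ (p * (Real.exp θ - 1)) hc (Finset.univ.sup f) s a)
  intro H hH
  refine ⟨f H, Finset.le_sup (f := f) (Finset.mem_univ H), ?_⟩
  simp only [Set.mem_ofPred_eq] at hH
  simp only [f, dif_pos hH]
  exact Nat.find_spec hH

end AdaptiveQueries

/-! ### Initial segments of random orderings -/

section RandomRanking

variable {V : Type*} [Fintype V]

open Classical in
/-- The orderings in which all elements of `T` are among the first `M` elements. -/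
noncomputable def rankingsBelow (M : ℕ) (T : Finset V) : Finset (Ranking V) :=
  {τ | ∀ v ∈ T, (τ v : ℕ) < M}

theorem mem_rankingsBelow {M : ℕ} {T : Finset V} {τ : Ranking V} :
    τ ∈ rankingsBelow M T ↔ ∀ v ∈ T, (τ v : ℕ) < M := by
  simp [rankingsBelow]

open Classical in
theorem card_filter_ranking_lt (τ : Ranking V) {M : ℕ} (hM : M ≤ Fintype.card V) :
    ({v | (τ v : ℕ) < M} : Finset V).card = M := by
  have : (({v | (τ v : ℕ) < M} : Finset V).map τ.toEmbedding) =
      ({i | (i : ℕ) < M} : Finset (Fin (Fintype.card V))) := by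
    ext i
    simp only [Finset.mem_map_equiv, Finset.mem_filter, Finset.mem_univ, true_and,
      Equiv.apply_symm_apply]
  rw [← Finset.card_map τ.toEmbedding, this, Fin.card_filter_val_lt, min_eq_right hM]

open Classical in
/-- Elements outside `T` are interchangeable. -/
theorem card_rankingsBelow_insert_eq (M : ℕ) (T : Finset V) {v w : V} (hv : v ∉ T)
    (hw : w ∉ T) :
    (rankingsBelow M (insert v T)).card = (rankingsBelow M (insert w T)).card := by
  refine Finset.card_bij' (fun τ _ => (Equiv.swap v w).trans τ)
    (fun τ _ => (Equiv.swap v w).trans τ) ?_ ?_ ?_ ?_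
  · intro τ hτ
    rw [mem_rankingsBelow] at hτ ⊢
    intro x hx
    rcases Finset.mem_insert.1 hx with rfl | hx
    · simpa using hτ v (by simp)
    · have h1 : x ≠ v := fun h => hv (h ▸ hx)
      have h2 : x ≠ w := fun h => hw (h ▸ hx)
      simpa [Equiv.swap_apply_of_ne_of_ne h1 h2] using hτ x (by simp [hx])
  · intro τ hτ
    rw [mem_rankingsBelow] at hτ ⊢
    intro x hx
    rcases Finset.mem_insert.1 hx with rfl | hx
    · simpa using hτ w (by simp)
    · have h1 : x ≠ v := fun h => hv (h ▸ hx)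
      have h2 : x ≠ w := fun h => hw (h ▸ hx)
      simpa [Equiv.swap_apply_of_ne_of_ne h1 h2] using hτ x (by simp [hx])
  · intro τ _; ext; simp
  · intro τ _; ext; simp

open Classical in
theorem card_rankingsBelow_insert_le {M : ℕ} {T : Finset V} {v : V} (hv : v ∉ T) :
    (rankingsBelow M (insert v T)).card * Fintype.card V ≤ (rankingsBelow M T).card * M := by
  have hsub : (rankingsBelow M (insert v T)).card ≤ (rankingsBelow M T).card := by
    refine Finset.card_le_card fun τ hτ => ?_
    rw [mem_rankingsBelow] at hτ ⊢
    exact fun x hx => hτ x (Finset.mem_insert_of_mem hx)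
  rcases le_or_gt (Fintype.card V) M with hM | hM
  · exact Nat.mul_le_mul hsub hM
  -- count pairs of an ordering in `rankingsBelow M T` and a further element of small rank
  have hcount : ∑ w ∈ Tᶜ, (rankingsBelow M (insert w T)).card + T.card * (rankingsBelow M T).card =
      M * (rankingsBelow M T).card := by
    have h1 : ∀ w, (rankingsBelow M (insert w T)).card =
        ∑ τ ∈ rankingsBelow M T, if (τ w : ℕ) < M then 1 else 0 := by
      intro w
      rw [← Finset.card_filter]
      congr 1
      ext τ
      simp [mem_rankingsBelow, and_comm]
    simp_rw [h1]
    rw [Finset.sum_comm, mul_comm, mul_comm M, ← smul_eq_mul, ← smul_eq_mul, ← Finset.sum_const,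
      ← Finset.sum_const, ← Finset.sum_add_distrib]
    refine Finset.sum_congr rfl fun τ hτ => ?_
    rw [mem_rankingsBelow] at hτ
    rw [← Finset.card_filter]
    have h2 : ({w ∈ Tᶜ | (τ w : ℕ) < M} : Finset V) =
        ({w | (τ w : ℕ) < M} : Finset V) \ T := by
      ext w; simp [and_comm]
    rw [h2, Finset.card_sdiff_add_card_eq_card, card_filter_ranking_lt τ hM.le]
    intro w hw
    simpa using hτ w hw
  rw [Finset.sum_congr rfl fun w hw =>
    card_rankingsBelow_insert_eq M T (Finset.mem_compl.1 hw) hv, Finset.sum_const, smul_eq_mul,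
    Finset.card_compl] at hcount
  have hT : T.card ≤ Fintype.card V := Finset.card_le_univ T
  obtain ⟨d, hd⟩ := Nat.exists_eq_add_of_le hT
  rw [hd] at hcount ⊢
  rw [Nat.add_sub_cancel_left] at hcount
  nlinarith

open Classical in
theorem card_rankingsBelow_mul_pow_le (M : ℕ) (T : Finset V) :
    (rankingsBelow M T).card * Fintype.card V ^ T.card ≤
      Fintype.card (Ranking V) * M ^ T.card := by
  induction T using Finset.induction_on with
  | empty => simpa using Finset.card_le_univ (rankingsBelow M (∅ : Finset V))
  | insert v T hv ih =>
    rw [Finset.card_insert_of_notMem hv]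
    calc _ = (rankingsBelow M (insert v T)).card * Fintype.card V * Fintype.card V ^ T.card := by
          ring
      _ ≤ (rankingsBelow M T).card * M * Fintype.card V ^ T.card :=
          Nat.mul_le_mul_right _ (card_rankingsBelow_insert_le hv)
      _ = (rankingsBelow M T).card * Fintype.card V ^ T.card * M := by ring
      _ ≤ Fintype.card (Ranking V) * M ^ T.card * M := Nat.mul_le_mul_right _ ih
      _ = _ := by ring

instance : Nonempty (Ranking V) := ⟨Fintype.equivFin V⟩

instance : IsProbabilityMeasure (uniformOn (Set.univ : Set (Ranking V))) :=
  isProbabilityMeasure_uniformOn Set.finite_univ Set.univ_nonempty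

open Classical in
theorem uniformOn_real_rankingsBelow_le [Nonempty V] (M : ℕ) (T : Finset V) :
    (uniformOn (Set.univ : Set (Ranking V))).real (rankingsBelow M T : Set (Ranking V)) ≤
      ((M : ℝ) / Fintype.card V) ^ T.card := by
  have hV : 0 < (Fintype.card V : ℝ) := by exact_mod_cast Fintype.card_pos
  have hR : 0 < (Fintype.card (Ranking V) : ℝ) := by exact_mod_cast Fintype.card_pos
  rw [measureReal_def, uniformOn_univ, Measure.count_apply_finset, ENNReal.toReal_div,
    ENNReal.toReal_natCast, ENNReal.toReal_natCast, div_pow, div_le_div_iff₀ hR (by positivity)]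
  have := card_rankingsBelow_mul_pow_le M T
  rw [mul_comm (_ ^ _)]
  exact_mod_cast this

open Classical in
/-- A set `F` is unlikely to have many more elements among the first `M` elements of a random
ordering than it has on average. -/
theorem uniformOn_real_card_filter_le [Nonempty V] (M r : ℕ) (F : Finset V)
    (hr : Real.exp 2 * (F.card * M) ≤ r * Fintype.card V) :
    (uniformOn (Set.univ : Set (Ranking V))).real
      {τ | r ≤ ({v ∈ F | (τ v : ℕ) < M} : Finset V).card} ≤ Real.exp (-r) := by
  have hV : 0 < (Fintype.card V : ℝ) := by exact_mod_cast Fintype.card_pos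
  have hsub : {τ : Ranking V | r ≤ ({v ∈ F | (τ v : ℕ) < M} : Finset V).card} ⊆
      ⋃ T ∈ F.powersetCard r, (rankingsBelow M T : Set (Ranking V)) := by
    intro τ hτ
    obtain ⟨T, hT, hTr⟩ := Finset.exists_subset_card_eq hτ
    simp only [Set.mem_iUnion, Finset.mem_coe, Finset.mem_powersetCard]
    refine ⟨T, ⟨hT.trans (Finset.filter_subset _ _), hTr⟩, mem_rankingsBelow.2 fun v hv => ?_⟩
    exact (Finset.mem_filter.1 (hT hv)).2
  refine (measureReal_mono hsub (measure_ne_top _ _)).trans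
    ((measureReal_biUnion_finset_le _ _).trans ?_)
  calc _ ≤ ∑ T ∈ F.powersetCard r, ((M : ℝ) / Fintype.card V) ^ r :=
        Finset.sum_le_sum fun T hT => by
          have := uniformOn_real_rankingsBelow_le M T
          rwa [(Finset.mem_powersetCard.1 hT).2] at this
    _ = (F.card.choose r : ℝ) * ((M : ℝ) / Fintype.card V) ^ r := by
        simp [Finset.card_powersetCard]
    _ ≤ ((F.card : ℝ) ^ r / r.factorial) * ((M : ℝ) / Fintype.card V) ^ r := by
        gcongr; exact Nat.choose_le_pow_div r F.card
    _ = ((F.card : ℝ) * M / Fintype.card V) ^ r / r.factorial := by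
        rw [mul_div_assoc, mul_pow]; ring
    _ ≤ (r * Real.exp (-2)) ^ r / r.factorial := by
        gcongr
        rw [div_le_iff₀ hV]
        have h1 : Real.exp (-2) * Real.exp 2 = 1 := by rw [← Real.exp_add]; simp
        calc (F.card : ℝ) * M = Real.exp (-2) * Real.exp 2 * (F.card * M) := by rw [h1, one_mul]
          _ = Real.exp (-2) * (Real.exp 2 * (F.card * M)) := by ring
          _ ≤ Real.exp (-2) * (r * Fintype.card V) := by gcongr
          _ = _ := by ring
    _ = (r : ℝ) ^ r / r.factorial * Real.exp (-(2 * r)) := by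
        rw [mul_pow, ← Real.exp_nat_mul]; ring_nf
    _ ≤ Real.exp r * Real.exp (-(2 * r)) := by
        gcongr; exact Real.pow_div_factorial_le_exp _ (by positivity) _
    _ = Real.exp (-r) := by rw [← Real.exp_add]; ring_nf

end RandomRanking

/-! ### The search as an adaptive query procedure -/

section First

variable {α : Type*} [Fintype α]

theorem Ranking.first_eq_none {σ : Ranking α} {A : Finset α} (h : σ.first A = none) : A = ∅ := by
  unfold Ranking.first at h
  split_ifs at h with hA
  simpa [Finset.not_nonempty_iff_eq_empty] using hA

theorem Ranking.mem_of_first_eq_some {σ : Ranking α} {A : Finset α} {v : α}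
    (h : σ.first A = some v) : v ∈ A := by
  unfold Ranking.first at h
  split_ifs at h with hA
  have := Finset.min'_mem _ hA
  rw [Finset.mem_map_equiv] at this
  simp only [Option.some.injEq] at h
  exact h ▸ this

theorem Ranking.le_of_first_eq_some {σ : Ranking α} {A : Finset α} {v w : α}
    (h : σ.first A = some v) (hw : w ∈ A) : σ v ≤ σ w := by
  unfold Ranking.first at h
  split_ifs at h with hA
  simp only [Option.some.injEq] at h
  rw [← h, Equiv.apply_symm_apply]
  exact Finset.min'_le _ _ (Finset.mem_map_of_mem _ hw)

theorem Ranking.mem_descending {σ : Ranking α} {A : Finset α} {v : α} :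
    v ∈ σ.descending A ↔ v ∈ A := by
  simp only [Ranking.descending, List.mem_map, Finset.mem_sort, Finset.mem_map_equiv]
  constructor
  · rintro ⟨a, ha, rfl⟩
    exact ha
  · intro hv
    exact ⟨σ v, by simpa using hv, by simp⟩

end First

namespace SearchAlg

variable {V E : Type*}

theorem stack_eq_nil_of_current_eq_none {alg : SearchAlg} {S : List V}
    (h : alg.current S = none) : S = [] := by
  cases alg <;> simpa [current] using h

theorem mem_stack_of_current_eq_some {alg : SearchAlg} {S : List V} {x : V}
    (h : alg.current S = some x) : x ∈ S := by
  cases alg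
  · exact List.mem_of_head? h
  · exact List.mem_of_head? h
  · exact List.mem_of_getLast? h
  · exact List.mem_of_getLast? h

theorem mayQuery_of_forall_neutral {alg : SearchAlg} {status : V → VertexStatus} {x : V}
    {e : Finset V} (hne : ∃ v ∈ e, v ≠ x) (h : ∀ v ∈ e, v ≠ x → status v = .neutral) :
    alg.MayQuery status x e := by
  obtain ⟨v, hv, hvx⟩ := hne
  cases alg
  · exact ⟨v, hv, h v hv hvx⟩
  · exact h
  · exact ⟨v, hv, h v hv hvx⟩
  · exact h

/-- The vertex with which a new component is started in state `s`, if there is one. -/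
noncomputable def start [Fintype V] (alg : SearchAlg) (τ : Ranking V) (s : SearchState V E) :
    Option V :=
  match alg.current s.stack with
  | none => τ.first {v | s.status v = .neutral}
  | some _ => none

theorem current_of_start [Fintype V] {alg : SearchAlg} {τ : Ranking V}
    {s : SearchState V E} {v : V} (h : alg.start τ s = some v) :
    alg.current s.stack = none ∧ τ.first {v | s.status v = .neutral} = some v := by
  unfold start at h
  split at h
  · rename_i hc; exact ⟨hc, h⟩
  · simp at h

variable [Fintype E]

open Classical in
/-- The edge that is queried from the current vertex in state `s`, if there is one. -/
noncomputable def query (alg : SearchAlg) (inc : E → Finset V) (σ : Ranking E)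
    (s : SearchState V E) : Option E :=
  match alg.current s.stack with
  | none => none
  | some x => σ.first {e | e ∉ s.queried ∧ x ∈ inc e ∧ alg.MayQuery s.status x (inc e)}

variable {alg : SearchAlg} {inc : E → Finset V} {σ : Ranking E}
  {s : SearchState V E}

theorem exists_current_of_query {e : E} (h : alg.query inc σ s = some e) :
    ∃ x, alg.current s.stack = some x ∧ x ∈ inc e ∧ e ∉ s.queried := by
  classical
  unfold query at h
  split at h
  · simp at h
  · rename_i x hx
    have := Ranking.mem_of_first_eq_some h
    simp only [Finset.mem_filter, Finset.mem_univ, true_and] at this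
    exact ⟨x, hx, this.2.1, this.1⟩

variable [Fintype V] {τ ρ : Ranking V} {H : Set E}

open Classical in
theorem status_step_of_query {e : E} (h : alg.query inc σ s = some e) :
    (alg.step inc σ τ ρ H s).status =
      fun v => if e ∈ H ∧ v ∈ inc e ∧ s.status v = .neutral then .active else s.status v := by
  obtain ⟨x, hx, -⟩ := exists_current_of_query h
  unfold query at h
  unfold step
  simp only [hx] at h ⊢
  rw [h]
  by_cases he : e ∈ H <;> simp [he]

theorem mem_stack_step_of_query {e : E} (h : alg.query inc σ s = some e) (v : V) :
    v ∈ (alg.step inc σ τ ρ H s).stack ↔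
      (e ∈ H ∧ v ∈ inc e ∧ s.status v = .neutral) ∨ v ∈ s.stack := by
  obtain ⟨x, hx, -⟩ := exists_current_of_query h
  unfold query at h
  unfold step
  simp only [hx] at h ⊢
  rw [h]
  by_cases he : e ∈ H <;> simp [he, Ranking.mem_descending]

open Classical in
theorem queried_step_of_query {e : E} (h : alg.query inc σ s = some e) :
    (alg.step inc σ τ ρ H s).queried = insert e s.queried := by
  obtain ⟨x, hx, -⟩ := exists_current_of_query h
  unfold query at h
  unfold step
  simp only [hx] at h ⊢
  rw [h]
  by_cases he : e ∈ H <;> simp [he]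

open Classical in
theorem step_of_start {v : V} (h : alg.start τ s = some v) :
    alg.step inc σ τ ρ H s =
      { status := Function.update s.status v .active, stack := [v], queried := s.queried } := by
  obtain ⟨hc, hv⟩ := current_of_start h
  unfold step
  simp only [hc]
  split
  · rename_i hx; rw [hv] at hx; cases hx; rfl
  · rename_i hx; rw [hv] at hx; cases hx

open Classical in
theorem step_of_query_eq_none {x : V} (hx : alg.current s.stack = some x)
    (h : alg.query inc σ s = none) :
    alg.step inc σ τ ρ H s =
      { status := Function.update s.status x .explored, stack := s.stack.erase x,
        queried := s.queried } := by
  unfold query at h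
  unfold step
  simp only [hx] at h ⊢
  rw [h]

/-- In the final phase, when there is no current vertex and no neutral vertex, only the set of
queried edges changes. -/
theorem step_of_current_eq_none (hc : alg.current s.stack = none) (h : alg.start τ s = none) :
    (alg.step inc σ τ ρ H s).status = s.status ∧ (alg.step inc σ τ ρ H s).stack = s.stack ∧
      s.queried ⊆ (alg.step inc σ τ ρ H s).queried ∧
      ∀ H', alg.step inc σ τ ρ H s = alg.step inc σ τ ρ H' s := by
  classical
  unfold start at h
  simp only [hc] at h
  unfold step
  simp only [hc]
  split
  · rename_i hx; rw [h] at hx; cases hx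
  · split <;> simp [Finset.subset_insert]

variable (alg inc σ τ ρ) in
theorem isAdaptiveQuery :
    IsAdaptiveQuery (alg.step inc σ τ ρ) (alg.query inc σ) (SearchState.queried) where
  fresh s e h := by
    obtain ⟨x, -, -, h⟩ := exists_current_of_query h
    exact h
  used_mono H s := by
    classical
    rcases hq : alg.query inc σ s with _ | e
    · rcases hc : alg.current s.stack with _ | x
      · rcases hs : alg.start τ s with _ | v
        · exact (step_of_current_eq_none hc hs).2.2.1
        · rw [step_of_start hs]
      · rw [step_of_query_eq_none hc hq]
    · rw [queried_step_of_query hq]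
      exact Finset.subset_insert _ _
  mem_used H s e h := by
    classical
    rw [queried_step_of_query h]
    exact Finset.mem_insert_self _ _
  step_congr H H' s h := by
    classical
    rcases hq : alg.query inc σ s with _ | e
    · rcases hc : alg.current s.stack with _ | x
      · rcases hs : alg.start τ s with _ | v
        · exact (step_of_current_eq_none hc hs).2.2.2 H'
        · rw [step_of_start hs, step_of_start hs]
      · rw [step_of_query_eq_none hc hq, step_of_query_eq_none hc hq]
    · have he := h e hq
      obtain ⟨x, hx, -⟩ := exists_current_of_query hq
      unfold query at hq
      unfold step
      simp only [hx] at hq ⊢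
      rw [hq]
      simp only [he]

/-! ### Invariants of the search -/

theorem status_step_explored {v : V} (h : s.status v = .explored) :
    (alg.step inc σ τ ρ H s).status v = .explored := by
  classical
  rcases hq : alg.query inc σ s with _ | e
  · rcases hc : alg.current s.stack with _ | x
    · rcases hs : alg.start τ s with _ | w
      · rw [(step_of_current_eq_none hc hs).1, h]
      · rw [step_of_start hs]
        have hw := Ranking.mem_of_first_eq_some (current_of_start hs).2
        have : v ≠ w := by
          rintro rfl
          simp [h] at hw
        simp [Function.update_of_ne this, h]
    · rw [step_of_query_eq_none hc hq]
      by_cases hv : v = x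
      · simp [hv]
      · simp [Function.update_of_ne hv, h]
  · rw [status_step_of_query hq]
    simp [h]

theorem status_step_ne_neutral {v : V} (h : s.status v ≠ .neutral) :
    (alg.step inc σ τ ρ H s).status v ≠ .neutral := by
  classical
  rcases hq : alg.query inc σ s with _ | e
  · rcases hc : alg.current s.stack with _ | x
    · rcases hs : alg.start τ s with _ | w
      · rwa [(step_of_current_eq_none hc hs).1]
      · rw [step_of_start hs]
        by_cases hv : v = w
        · simp [hv]
        · simpa [Function.update_of_ne hv] using h
    · rw [step_of_query_eq_none hc hq]
      by_cases hv : v = x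
      · simp [hv]
      · simpa [Function.update_of_ne hv] using h
  · rw [status_step_of_query hq]
    simp [h]

/-- A vertex is discovered either as the start of a component or through a present edge. -/
theorem start_or_query_of_discovered {v : V} (h : s.status v = .neutral)
    (h' : (alg.step inc σ τ ρ H s).status v ≠ .neutral)
    (hstack : ∀ w ∈ s.stack, s.status w ≠ .neutral) :
    alg.start τ s = some v ∨ ∃ e, alg.query inc σ s = some e ∧ e ∈ H ∧ v ∈ inc e := by
  classical
  rcases hq : alg.query inc σ s with _ | e
  · left
    rcases hc : alg.current s.stack with _ | x
    · rcases hs : alg.start τ s with _ | w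
      · rw [(step_of_current_eq_none hc hs).1] at h'
        exact absurd h h'
      · rw [step_of_start hs] at h'
        by_cases hv : v = w
        · rw [hv]
        · simp [Function.update_of_ne hv, h] at h'
    · rw [step_of_query_eq_none hc hq] at h'
      have hv : v ≠ x := by
        rintro rfl
        exact hstack _ (mem_stack_of_current_eq_some hc) h
      simp [Function.update_of_ne hv, h] at h'
  · right
    rw [status_step_of_query hq] at h'
    refine ⟨e, rfl, ?_⟩
    by_contra hcon
    simp [h] at h'
    exact hcon h'

/-- The stack contains only discovered vertices and all active vertices, and edges all whose
vertices are neutral apart from one explored vertex (and which have another vertex) have been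
queried. -/
structure Invariant (inc : E → Finset V) (s : SearchState V E) : Prop where
  stack_ne_neutral : ∀ v ∈ s.stack, s.status v ≠ .neutral
  active_mem_stack : ∀ v, s.status v = .active → v ∈ s.stack
  queried_of_explored : ∀ v e, s.status v = .explored → v ∈ inc e → (∃ w ∈ inc e, w ≠ v) →
    (∀ w ∈ inc e, w ≠ v → s.status w = .neutral) → e ∈ s.queried

theorem Invariant.step (h : Invariant inc s) : Invariant inc (alg.step inc σ τ ρ H s) := by
  classical
  refine ⟨?_, ?_, ?_⟩
  · intro v hv
    rcases hq : alg.query inc σ s with _ | e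
    · rcases hc : alg.current s.stack with _ | x
      · rcases hs : alg.start τ s with _ | w
        · rw [(step_of_current_eq_none hc hs).2.1] at hv
          exact status_step_ne_neutral (h.1 v hv)
        · rw [step_of_start hs] at hv ⊢
          simp only [List.mem_singleton] at hv
          simp [hv]
      · refine status_step_ne_neutral (h.1 v ?_)
        rw [step_of_query_eq_none hc hq] at hv
        exact List.mem_of_mem_erase hv
    · rw [mem_stack_step_of_query hq] at hv
      rcases hv with hv | hv
      · rw [status_step_of_query hq]
        simp [hv]
      · exact status_step_ne_neutral (h.1 v hv)
  · intro v hv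
    rcases hq : alg.query inc σ s with _ | e
    · rcases hc : alg.current s.stack with _ | x
      · rcases hs : alg.start τ s with _ | w
        · rw [(step_of_current_eq_none hc hs).1] at hv
          rw [(step_of_current_eq_none hc hs).2.1]
          exact h.2 v hv
        · rw [step_of_start hs] at hv ⊢
          by_cases hvw : v = w
          · simp [hvw]
          · have := h.2 v (by simpa [Function.update_of_ne hvw] using hv)
            simp [stack_eq_nil_of_current_eq_none hc] at this
      · rw [step_of_query_eq_none hc hq] at hv ⊢
        by_cases hvx : v = x
        · simp [hvx] at hv
        · exact (List.mem_erase_of_ne hvx).2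
            (h.2 v (by simpa [Function.update_of_ne hvx] using hv))
    · rw [mem_stack_step_of_query hq]
      rw [status_step_of_query hq] at hv
      by_cases hc : e ∈ H ∧ v ∈ inc e ∧ s.status v = .neutral
      · exact Or.inl hc
      · exact Or.inr (h.2 v (by simpa [hc] using hv))
  · intro v e hv hve hne hw
    have hw' : ∀ w ∈ inc e, w ≠ v → s.status w = .neutral := fun w hwe hwv => by
      by_contra hcon
      exact status_step_ne_neutral hcon (hw w hwe hwv)
    by_cases hvs : s.status v = .explored
    · exact (alg.isAdaptiveQuery inc σ τ ρ).used_mono H s (h.3 v e hvs hve hne hw')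
    -- `v` has just been explored, because no edge could be queried from it
    have hcur : alg.current s.stack = some v ∧ alg.query inc σ s = none := by
      rcases hq : alg.query inc σ s with _ | e'
      · rcases hc : alg.current s.stack with _ | x
        · rcases hs : alg.start τ s with _ | w
          · rw [(step_of_current_eq_none hc hs).1] at hv
            exact absurd hv hvs
          · rw [step_of_start hs] at hv
            by_cases hvw : v = w
            · simp [hvw] at hv
            · simp [Function.update_of_ne hvw, hvs] at hv
        · rw [step_of_query_eq_none hc hq] at hv
          by_cases hvx : v = x
          · simp [hvx]
          · simp [Function.update_of_ne hvx, hvs] at hv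
      · rw [status_step_of_query hq] at hv
        by_cases hc : e' ∈ H ∧ v ∈ inc e' ∧ s.status v = .neutral
        · simp [hc] at hv
        · simp [hc, hvs] at hv
    refine (alg.isAdaptiveQuery inc σ τ ρ).used_mono H s ?_
    obtain ⟨hc, hq⟩ := hcur
    unfold query at hq
    simp only [hc] at hq
    have := Ranking.first_eq_none hq
    by_contra hcon
    have hmem : e ∈ (∅ : Finset E) := by
      rw [← this]
      simp only [Finset.mem_filter, Finset.mem_univ, true_and]
      exact ⟨hcon, hve, mayQuery_of_forall_neutral hne hw'⟩
    simp at hmem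

variable (alg inc σ τ ρ H)

theorem run_succ (i : ℕ) :
    alg.run inc σ τ ρ H (i + 1) = alg.step inc σ τ ρ H (alg.run inc σ τ ρ H i) :=
  Function.iterate_succ_apply' _ _ _

theorem invariant_run (i : ℕ) : Invariant inc (alg.run inc σ τ ρ H i) := by
  induction i with
  | zero =>
    refine ⟨?_, ?_, ?_⟩ <;> simp [run, SearchState.init]
  | succ i ih =>
    rw [run_succ]
    exact ih.step

theorem card_queried_run_mono : Monotone fun i => (alg.run inc σ τ ρ H i).queried.card :=
  monotone_nat_of_le_succ fun i => by
    rw [run_succ]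
    exact Finset.card_le_card ((alg.isAdaptiveQuery inc σ τ ρ).used_mono H _)

/-- The vertices discovered after `i` steps. -/
noncomputable def discoveredAt (i : ℕ) : Finset V :=
  {v | (alg.run inc σ τ ρ H i).status v ≠ .neutral}

/-- The vertices explored after `i` steps. -/
noncomputable def exploredAt (i : ℕ) : Finset V :=
  {v | (alg.run inc σ τ ρ H i).status v = .explored}

open Classical in
/-- The vertices with which a component was started in the first `i` steps. -/
noncomputable def startersAt (i : ℕ) : Finset V :=
  {v | ∃ r < i, alg.start τ (alg.run inc σ τ ρ H r) = some v}

variable {alg inc σ τ ρ H}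

theorem mem_discoveredAt {i : ℕ} {v : V} : v ∈ alg.discoveredAt inc σ τ ρ H i ↔
    (alg.run inc σ τ ρ H i).status v ≠ .neutral := by
  simp [discoveredAt]

theorem mem_exploredAt {i : ℕ} {v : V} : v ∈ alg.exploredAt inc σ τ ρ H i ↔
    (alg.run inc σ τ ρ H i).status v = .explored := by
  simp [exploredAt]

theorem mem_startersAt {i : ℕ} {v : V} : v ∈ alg.startersAt inc σ τ ρ H i ↔
    ∃ r < i, alg.start τ (alg.run inc σ τ ρ H r) = some v := by
  simp [startersAt]

variable (alg inc σ τ ρ H)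

theorem discoveredAt_mono : Monotone (alg.discoveredAt inc σ τ ρ H) :=
  monotone_nat_of_le_succ fun i v hv => by
    rw [mem_discoveredAt] at hv ⊢
    rw [run_succ]
    exact status_step_ne_neutral hv

theorem exploredAt_subset_succ (i : ℕ) :
    alg.exploredAt inc σ τ ρ H i ⊆ alg.exploredAt inc σ τ ρ H (i + 1) := fun v hv => by
  rw [mem_exploredAt] at hv ⊢
  rw [run_succ]
  exact status_step_explored hv

theorem startersAt_mono : Monotone (alg.startersAt inc σ τ ρ H) := fun i i' hi v hv => by
  rw [mem_startersAt] at hv ⊢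
  obtain ⟨r, hr, hv⟩ := hv
  exact ⟨r, by omega, hv⟩

variable {alg inc σ τ ρ H}

theorem startersAt_succ {i : ℕ} {v : V} (h : v ∈ alg.startersAt inc σ τ ρ H (i + 1)) :
    v ∈ alg.startersAt inc σ τ ρ H i ∨ alg.start τ (alg.run inc σ τ ρ H i) = some v := by
  rw [mem_startersAt] at h
  obtain ⟨r, hr, hv⟩ := h
  rcases Nat.lt_succ_iff_lt_or_eq.1 hr with hr | rfl
  · exact Or.inl (mem_startersAt.2 ⟨r, hr, hv⟩)
  · exact Or.inr hv

variable (alg inc σ τ ρ H)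

theorem startersAt_subset_discoveredAt (i : ℕ) :
    alg.startersAt inc σ τ ρ H i ⊆ alg.discoveredAt inc σ τ ρ H i := by
  classical
  intro v hv
  obtain ⟨r, hr, hv⟩ := mem_startersAt.1 hv
  refine discoveredAt_mono alg inc σ τ ρ H hr ?_
  rw [mem_discoveredAt, Nat.succ_eq_add_one, run_succ, step_of_start hv]
  simp

/-- A component is started only when all components started earlier are explored. -/
theorem card_startersAt_le (i : ℕ) :
    (alg.startersAt inc σ τ ρ H i).card ≤ (alg.exploredAt inc σ τ ρ H i).card + 1 := by
  classical
  suffices (alg.startersAt inc σ τ ρ H i \ alg.exploredAt inc σ τ ρ H i).card ≤ 1 by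
    have := Finset.card_le_card_sdiff_add_card (s := alg.startersAt inc σ τ ρ H i)
      (t := alg.exploredAt inc σ τ ρ H i)
    omega
  induction i with
  | zero => simp [startersAt]
  | succ i ih =>
    rcases hs : alg.start τ (alg.run inc σ τ ρ H i) with _ | v
    · refine (Finset.card_le_card (Finset.sdiff_subset_sdiff (fun w hw => ?_)
        (exploredAt_subset_succ alg inc σ τ ρ H i))).trans ih
      rcases startersAt_succ hw with hw | hw
      · exact hw
      · rw [hs] at hw; cases hw
    · refine (Finset.card_le_card (t := {v}) fun w hw => ?_).trans (by simp)
      rw [Finset.mem_sdiff] at hw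
      rcases startersAt_succ hw.1 with hw' | hw'
      · refine absurd ?_ hw.2
        refine exploredAt_subset_succ alg inc σ τ ρ H i ?_
        have h1 := mem_discoveredAt.1 (startersAt_subset_discoveredAt alg inc σ τ ρ H i hw')
        have h2 := (invariant_run alg inc σ τ ρ H i).active_mem_stack w
        rw [stack_eq_nil_of_current_eq_none (current_of_start hs).1] at h2
        rw [mem_exploredAt]
        cases hst : (alg.run inc σ τ ρ H i).status w
        · exact absurd hst h1
        · simpa using h2 hst
        · rfl
      · rw [hs] at hw'
        simpa using hw'.symm

theorem card_startersAt_succ_le (i : ℕ) :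
    (alg.startersAt inc σ τ ρ H (i + 1)).card ≤ (alg.startersAt inc σ τ ρ H i).card + 1 := by
  classical
  rcases hs : alg.start τ (alg.run inc σ τ ρ H i) with _ | v
  · refine (Finset.card_le_card fun w hw => ?_).trans (Nat.le_succ _)
    simpa [hs] using startersAt_succ hw
  · refine (Finset.card_le_card (t := insert v (alg.startersAt inc σ τ ρ H i)) fun w hw => ?_).trans
      (Finset.card_insert_le _ _)
    simpa [hs, eq_comm, or_comm] using startersAt_succ hw

/-- All vertices of smaller rank than a starting vertex are discovered before it, so its rank is
at most the number of discovered vertices. -/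
theorem rank_le_of_mem_startersAt {i : ℕ} {v : V} (h : v ∈ alg.startersAt inc σ τ ρ H i) :
    (τ v : ℕ) ≤ (alg.discoveredAt inc σ τ ρ H i).card := by
  classical
  obtain ⟨r, hr, hv⟩ := mem_startersAt.1 h
  rw [← card_filter_ranking_lt τ (τ v).2.le]
  refine Finset.card_le_card fun w hw => discoveredAt_mono alg inc σ τ ρ H hr.le ?_
  rw [mem_discoveredAt]
  intro hcon
  have := Ranking.le_of_first_eq_some (current_of_start hv).2 (w := w) (by simpa using hcon)
  simp only [Finset.mem_filter, Finset.mem_univ, true_and] at hw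
  exact absurd hw (not_lt.2 this)

/-- An edge whose only discovered vertex is explored has been queried, and such edges are
different for different explored vertices. -/
theorem card_exploredAt_mul_le (i u : ℕ)
    (hu : ∀ v ∈ alg.exploredAt inc σ τ ρ H i, ∃ U : Finset E, u ≤ U.card ∧ ∀ e ∈ U,
      v ∈ inc e ∧ (∃ w ∈ inc e, w ≠ v) ∧
        ∀ w ∈ inc e, w ≠ v → w ∉ alg.discoveredAt inc σ τ ρ H i) :
    (alg.exploredAt inc σ τ ρ H i).card * u ≤ (alg.run inc σ τ ρ H i).queried.card := by
  classical
  choose! U hUc hU using hu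
  rw [← smul_eq_mul, ← Finset.sum_const]
  refine (Finset.sum_le_sum hUc).trans ?_
  rw [← Finset.card_biUnion]
  · refine Finset.card_le_card fun e he => ?_
    obtain ⟨v, hv, he⟩ := Finset.mem_biUnion.1 he
    have he := hU v hv e he
    refine (invariant_run alg inc σ τ ρ H i).queried_of_explored v e (mem_exploredAt.1 hv)
      he.1 he.2.1 fun w hw hwv => ?_
    simpa [mem_discoveredAt] using he.2.2 w hw hwv
  · intro v hv w hw hvw
    refine Finset.disjoint_left.2 fun e he he' => ?_
    refine (hU v hv e he).2.2 w (hU w hw e he').1 hvw.symm (mem_discoveredAt.2 ?_)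
    rw [mem_exploredAt.1 hw]
    simp

/-! ### Counting discovered vertices of a given kind -/

variable (V E) in
/-- The states in which the current vertex belongs to `F`. -/
def currentIn (alg : SearchAlg) (F : Finset V) : Set (SearchState V E) :=
  {s | ∃ x ∈ F, alg.current s.stack = some x}

/-- The states in which an edge meeting `F` is queried from a current vertex outside `F`. -/
def jumpInto (alg : SearchAlg) (inc : E → Finset V) (σ : Ranking E) (F : Finset V) :
    Set (SearchState V E) :=
  {s | ∃ x ∉ F, alg.current s.stack = some x ∧
    ∃ e, alg.query inc σ s = some e ∧ ∃ v ∈ inc e, v ∈ F}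

/-- A vertex of `F` is discovered as a starting vertex, through an edge found from within `F`
(which discovers at most `a` others), or through an edge found from outside `F`. -/
theorem card_discoveredAt_inter_le [DecidableEq V] (F : Finset V) (a b : ℕ)
    (ha : ∀ e, ∀ x ∈ F, x ∈ inc e → (inc e ∩ F).card ≤ a + 1)
    (hb : ∀ e, (inc e ∩ F).card ≤ b) (i : ℕ) :
    (alg.discoveredAt inc σ τ ρ H i ∩ F).card ≤ (alg.startersAt inc σ τ ρ H i ∩ F).card +
      a * hits (alg.step inc σ τ ρ) (alg.query inc σ) (alg.currentIn V E F) H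
        (SearchState.init V E) i +
      b * hits (alg.step inc σ τ ρ) (alg.query inc σ) (alg.jumpInto inc σ F) H
        (SearchState.init V E) i := by
  induction i with
  | zero =>
    simp [discoveredAt, run, SearchState.init]
  | succ i ih =>
    have hin := Nat.mul_le_mul_left a (hits_le_succ (step := alg.step inc σ τ ρ)
      (query := alg.query inc σ) (alg.currentIn V E F) H (SearchState.init V E) i)
    have hjump := Nat.mul_le_mul_left b (hits_le_succ (step := alg.step inc σ τ ρ)
      (query := alg.query inc σ) (alg.jumpInto inc σ F) H (SearchState.init V E) i)
    have hinv := invariant_run alg inc σ τ ρ H i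
    have hnew : ∀ v ∈ alg.discoveredAt inc σ τ ρ H (i + 1),
        v ∈ alg.discoveredAt inc σ τ ρ H i ∨ (v ∉ alg.discoveredAt inc σ τ ρ H i ∧
        (alg.start τ (alg.run inc σ τ ρ H i) = some v ∨
        ∃ e, alg.query inc σ (alg.run inc σ τ ρ H i) = some e ∧ e ∈ H ∧ v ∈ inc e)) := by
      intro v hv
      by_cases hv' : v ∈ alg.discoveredAt inc σ τ ρ H i
      · exact Or.inl hv'
      · refine Or.inr ⟨hv', ?_⟩
        rw [mem_discoveredAt, run_succ] at hv
        exact start_or_query_of_discovered (by simpa [mem_discoveredAt] using hv') hv hinv.1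
    have hstart : (alg.startersAt inc σ τ ρ H i ∩ F).card ≤
        (alg.startersAt inc σ τ ρ H (i + 1) ∩ F).card :=
      Finset.card_le_card (Finset.inter_subset_inter_right
        (startersAt_mono alg inc σ τ ρ H (Nat.le_succ i)))
    by_cases hq : ∃ e, alg.query inc σ (alg.run inc σ τ ρ H i) = some e ∧ e ∈ H
    · obtain ⟨e, he, heH⟩ := hq
      obtain ⟨x, hx, hxe, -⟩ := exists_current_of_query he
      have hsub : alg.discoveredAt inc σ τ ρ H (i + 1) ∩ F ⊆
          (alg.discoveredAt inc σ τ ρ H i ∩ F) ∪ ((inc e ∩ F).erase x) := by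
        intro v hv
        rw [Finset.mem_inter] at hv
        rw [Finset.mem_union, Finset.mem_inter]
        rcases hnew v hv.1 with h | ⟨h, h' | ⟨e', he', -, hve⟩⟩
        · exact Or.inl ⟨h, hv.2⟩
        · rw [(current_of_start h').1] at hx
          cases hx
        · rw [he] at he'
          cases he'
          refine Or.inr (Finset.mem_erase.2 ⟨?_, Finset.mem_inter.2 ⟨hve, hv.2⟩⟩)
          rintro rfl
          exact h (mem_discoveredAt.2 (hinv.1 v (mem_stack_of_current_eq_some hx)))
      have hcard := (Finset.card_le_card hsub).trans (Finset.card_union_le _ _)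
      by_cases hxF : x ∈ F
      · have h1 : alg.run inc σ τ ρ H i ∈ alg.currentIn V E F := ⟨x, hxF, hx⟩
        rw [hits_succ_of_mem (P := alg.currentIn V E F) h1 he heH]
        have h2 : ((inc e ∩ F).erase x).card ≤ a := by
          rw [Finset.card_erase_of_mem (Finset.mem_inter.2 ⟨hxe, hxF⟩)]
          have := ha e x hxF hxe
          omega
        rw [mul_add, mul_one]
        omega
      · rcases (inc e ∩ F).eq_empty_or_nonempty with hemp | ⟨v, hv⟩
        · rw [hemp] at hcard
          simp only [Finset.erase_empty, Finset.card_empty, add_zero] at hcard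
          omega
        · have h1 : alg.run inc σ τ ρ H i ∈ alg.jumpInto inc σ F :=
            ⟨x, hxF, hx, e, he, v, (Finset.mem_inter.1 hv).1, (Finset.mem_inter.1 hv).2⟩
          rw [hits_succ_of_mem (P := alg.jumpInto inc σ F) h1 he heH]
          have h2 : ((inc e ∩ F).erase x).card ≤ b := (Finset.card_erase_le).trans (hb e)
          rw [mul_add, mul_one]
          omega
    · have hgrow : (alg.discoveredAt inc σ τ ρ H (i + 1) ∩ F).card +
          (alg.startersAt inc σ τ ρ H i ∩ F).card ≤
          (alg.discoveredAt inc σ τ ρ H i ∩ F).card +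
          (alg.startersAt inc σ τ ρ H (i + 1) ∩ F).card := by
        have hsub : (alg.discoveredAt inc σ τ ρ H (i + 1) ∩ F) \
            (alg.discoveredAt inc σ τ ρ H i ∩ F) ⊆
            (alg.startersAt inc σ τ ρ H (i + 1) ∩ F) \ (alg.startersAt inc σ τ ρ H i ∩ F) := by
          intro v hv
          simp only [Finset.mem_sdiff, Finset.mem_inter, not_and] at hv ⊢
          rcases hnew v hv.1.1 with h | ⟨h, h' | ⟨e', he', heH, hve⟩⟩
          · exact absurd hv.1.2 (hv.2 h)
          · refine ⟨⟨mem_startersAt.2 ⟨i, by omega, h'⟩, hv.1.2⟩, fun h'' => ?_⟩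
            exact absurd (startersAt_subset_discoveredAt alg inc σ τ ρ H i h'') h
          · exact absurd ⟨e', he', heH⟩ hq
        have h1 := Finset.card_le_card hsub
        have h2 := Finset.card_sdiff_add_card_eq_card (Finset.inter_subset_inter_right (u := F)
          (discoveredAt_mono alg inc σ τ ρ H (Nat.le_succ i)))
        have h3 := Finset.card_sdiff_add_card_eq_card (Finset.inter_subset_inter_right (u := F)
          (startersAt_mono alg inc σ τ ρ H (Nat.le_succ i)))
        simp only [Nat.succ_eq_add_one] at h2 h3
        omega
      omega

theorem trials_currentIn_le [DecidableEq V] (F : Finset V) (i d : ℕ) (U : V → Finset E)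
    (hU : ∀ x e, x ∈ inc e → e ∈ U x) (hd : ∀ x ∈ F, (U x).card ≤ d) :
    trials (alg.step inc σ τ ρ) (alg.query inc σ) (alg.currentIn V E F) H
        (SearchState.init V E) i ≤ (alg.discoveredAt inc σ τ ρ H i ∩ F).card * d := by
  classical
  refine ((alg.isAdaptiveQuery inc σ τ ρ).trials_le_card _ H _ i
    ((alg.discoveredAt inc σ τ ρ H i ∩ F).biUnion U) ?_).trans
    (Finset.card_biUnion_le_card_mul _ _ _ fun x hx => hd x (Finset.mem_inter.1 hx).2)
  intro r hr e hP he
  obtain ⟨x, hxF, hx⟩ := hP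
  obtain ⟨x', hx', hxe, -⟩ := exists_current_of_query he
  have : x = x' := by simpa [hx] using hx'
  subst this
  refine Finset.mem_biUnion.2 ⟨x, Finset.mem_inter.2 ⟨?_, hxF⟩, hU x e hxe⟩
  refine discoveredAt_mono alg inc σ τ ρ H hr.le (mem_discoveredAt.2 ?_)
  exact (invariant_run alg inc σ τ ρ H r).1 x (mem_stack_of_current_eq_some hx)

theorem trials_jumpInto_le [DecidableEq V] (F : Finset V) (i : ℕ) (U : V → Finset E)
    (hU : ∀ x e, x ∈ inc e → (∃ v ∈ inc e, v ∈ F) → e ∈ U x) :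
    trials (alg.step inc σ τ ρ) (alg.query inc σ) (alg.jumpInto inc σ F) H
        (SearchState.init V E) i ≤ ∑ x ∈ alg.discoveredAt inc σ τ ρ H i \ F, (U x).card := by
  classical
  refine ((alg.isAdaptiveQuery inc σ τ ρ).trials_le_card _ H _ i
    ((alg.discoveredAt inc σ τ ρ H i \ F).biUnion U) ?_).trans Finset.card_biUnion_le
  intro r hr e hP he
  obtain ⟨x, hxF, hx, e₁, he₁, hF⟩ := hP
  obtain ⟨x', hx', hxe, -⟩ := exists_current_of_query he
  have : x = x' := by simpa [hx] using hx'
  subst this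
  have he : alg.query inc σ (alg.run inc σ τ ρ H r) = some e := he
  have he₁ : alg.query inc σ (alg.run inc σ τ ρ H r) = some e₁ := he₁
  rw [he] at he₁
  cases he₁
  refine Finset.mem_biUnion.2 ⟨x, Finset.mem_sdiff.2 ⟨?_, hxF⟩, hU x e hxe hF⟩
  refine discoveredAt_mono alg inc σ τ ρ H hr.le (mem_discoveredAt.2 ?_)
  exact (invariant_run alg inc σ τ ρ H r).1 x (mem_stack_of_current_eq_some hx)

theorem trials_le_card_queried (P : Set (SearchState V E)) (i : ℕ) :
    trials (alg.step inc σ τ ρ) (alg.query inc σ) P H (SearchState.init V E) i ≤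
      (alg.run inc σ τ ρ H i).queried.card := by
  refine (alg.isAdaptiveQuery inc σ τ ρ).trials_le_card _ H _ i _ fun r hr e _ he => ?_
  have hmono : Monotone fun i => (alg.run inc σ τ ρ H i).queried :=
    monotone_nat_of_le_succ fun i => by
      rw [run_succ]
      exact (alg.isAdaptiveQuery inc σ τ ρ).used_mono H _
  refine hmono (Nat.succ_le_of_lt hr) ?_
  simp only [Nat.succ_eq_add_one, run_succ]
  exact (alg.isAdaptiveQuery inc σ τ ρ).mem_used H _ e he

end SearchAlg

/-! ### Counting sets of a given size -/

variable {n k j : ℕ}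

/-- The `r`-subsets of `[n]` which contain `A`. -/
def supersets (n r : ℕ) (A : Finset (Fin n)) : Finset (SetOfSize n r) := {s | A ⊆ s.1}

@[simp]
theorem mem_supersets {r : ℕ} {A : Finset (Fin n)} {s : SetOfSize n r} :
    s ∈ supersets n r A ↔ A ⊆ s.1 := by
  simp [supersets]

theorem card_supersets {r : ℕ} {A : Finset (Fin n)} (hr : A.card ≤ r) :
    (supersets n r A).card = (n - A.card).choose (r - A.card) := by
  have := Finset.card_filter_powersetCard_subset A _ r (Finset.subset_univ A) hr
  rw [Finset.card_univ, Fintype.card_fin] at this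
  rw [← this, ← Finset.card_map (Function.Embedding.subtype _)]
  congr 1
  ext s
  simp [and_comm]

theorem card_supersets_le (r : ℕ) (A : Finset (Fin n)) :
    (supersets n r A).card * n ^ A.card ≤ n ^ r := by
  rcases le_or_gt A.card r with hr | hr
  · rw [card_supersets hr]
    calc _ ≤ (n - A.card) ^ (r - A.card) * n ^ A.card :=
          Nat.mul_le_mul_right _ (Nat.choose_le_pow _ _)
      _ ≤ n ^ (r - A.card) * n ^ A.card :=
          Nat.mul_le_mul_right _ (Nat.pow_le_pow_left (Nat.sub_le _ _) _)
      _ = n ^ r := by rw [← pow_add, Nat.sub_add_cancel hr]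
  · have : supersets n r A = ∅ := by
      ext s
      simp only [mem_supersets, Finset.notMem_empty, iff_false]
      intro h
      have := Finset.card_le_card h
      rw [s.2] at this
      omega
    simp [this]

theorem mem_jSubsets {K : SetOfSize n k} {J : SetOfSize n j} :
    J ∈ jSubsets n k j K ↔ J.1 ⊆ K.1 := by
  simp [jSubsets]

theorem card_jSubsets_inter_supersets {K : SetOfSize n k} {L : Finset (Fin n)} (hLK : L ⊆ K.1)
    (hL : L.card ≤ j) :
    (jSubsets n k j K ∩ supersets n j L).card = (k - L.card).choose (j - L.card) := by
  have := Finset.card_filter_powersetCard_subset L _ j hLK hL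
  rw [K.2] at this
  rw [← this, ← Finset.card_map (Function.Embedding.subtype _)]
  congr 1
  ext s
  simp [mem_jSubsets, and_comm, and_left_comm]

theorem card_jSubsets (K : SetOfSize n k) : (jSubsets n k j K).card = k.choose j := by
  have := card_jSubsets_inter_supersets (j := j) (Finset.empty_subset K.1) (Nat.zero_le _)
  rw [Finset.inter_eq_left.2 fun J _ => by simp] at this
  simpa using this

theorem card_jSubsets_inter_le (K : SetOfSize n k) (F : Finset (SetOfSize n j)) :
    (jSubsets n k j K ∩ F).card ≤ k.choose j :=
  (Finset.card_le_card Finset.inter_subset_left).trans (card_jSubsets K).le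

theorem choose_sub_sub_le (hjk : j ≤ k) {ℓ : ℕ} (h1 : 1 ≤ ℓ) (hℓ : ℓ ≤ j) :
    (k - ℓ).choose (j - ℓ) ≤ (k - 1).choose (j - 1) := by
  rw [← Nat.choose_symm_of_eq_add (show k - ℓ = (k - j) + (j - ℓ) by omega),
    ← Nat.choose_symm_of_eq_add (show k - 1 = (k - j) + (j - 1) by omega)]
  exact Nat.choose_le_choose _ (by omega)

/-- Not all `j`-subsets of a `k`-set contain the nonempty set `L`, so a `j`-set containing `L` has
at most `k.choose j - 2` others beside it in a `k`-set. This makes the exploration at `L`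
subcritical. -/
theorem card_jSubsets_inter_supersets_le (hjk : j < k) (hj : 1 ≤ j) {K : SetOfSize n k}
    {L : Finset (Fin n)} (h1 : 1 ≤ L.card) (hL : L.card ≤ j) {J : SetOfSize n j}
    (hJ : J ∈ supersets n j L) (hJK : J ∈ jSubsets n k j K) :
    (jSubsets n k j K ∩ supersets n j L).card ≤ k.choose j - 2 + 1 := by
  rw [card_jSubsets_inter_supersets ((mem_supersets.1 hJ).trans (mem_jSubsets.1 hJK)) hL]
  refine (choose_sub_sub_le hjk.le h1 hL).trans ?_
  obtain ⟨k, rfl⟩ : ∃ k', k = k' + 1 := ⟨k - 1, by omega⟩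
  obtain ⟨j, rfl⟩ : ∃ j', j = j' + 1 := ⟨j - 1, by omega⟩
  rw [Nat.choose_succ_succ']
  have h2 : 0 < k.choose (j + 1) := Nat.choose_pos (by omega)
  have h3 : 0 < k.choose j := Nat.choose_pos (by omega)
  simp only [Nat.add_sub_cancel]
  omega

/-- The number of pairs of a `j`-set `x` of a family `D` and a `k`-set containing both `x` and `L`,
where `x` does not contain `L`: group the pairs by `x ∩ L` and use the degrees in `D`. -/
theorem sum_card_supersets_union_le (hn : 1 ≤ n) (D : Finset (SetOfSize n j))
    (L : Finset (Fin n)) (c : ℝ) (hc : 0 ≤ c)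
    (hL : L.card ≤ j)
    (hD : ∀ I ⊂ L, ((D ∩ supersets n j I).card : ℝ) ≤ c * (n : ℝ) ^ (j - I.card)) :
    ∑ x ∈ D \ supersets n j L, ((supersets n k (x.1 ∪ L)).card : ℝ) ≤
      2 ^ L.card * (c * ((n : ℝ) ^ k / (n : ℝ) ^ L.card)) := by
  have hn' : (0 : ℝ) < n := by exact_mod_cast hn
  have hmaps : ∀ x ∈ D \ supersets n j L, x.1 ∩ L ∈ L.ssubsets := by
    intro x hx
    rw [Finset.mem_sdiff, mem_supersets] at hx
    rw [Finset.mem_ssubsets]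
    refine ⟨Finset.inter_subset_right, fun h => hx.2 (h.trans Finset.inter_subset_left)⟩
  rw [← Finset.sum_fiberwise_of_maps_to hmaps]
  have hterm : ∀ I ∈ L.ssubsets, ∑ x ∈ D \ supersets n j L with x.1 ∩ L = I,
      ((supersets n k (x.1 ∪ L)).card : ℝ) ≤ c * ((n : ℝ) ^ k / (n : ℝ) ^ L.card) := by
    intro I hI
    have hIL := Finset.mem_ssubsets.1 hI
    have hIc : I.card ≤ L.card := Finset.card_le_card hIL.1
    have h1 : ∀ x ∈ (D \ supersets n j L).filter (fun x => x.1 ∩ L = I),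
        ((supersets n k (x.1 ∪ L)).card : ℝ) ≤ (n : ℝ) ^ k / (n : ℝ) ^ (j + L.card - I.card) := by
      intro x hx
      have hxI := (Finset.mem_filter.1 hx).2
      have hcard : (x.1 ∪ L).card = j + L.card - I.card := by
        have := Finset.card_union_add_card_inter x.1 L
        rw [hxI, x.2] at this
        omega
      rw [le_div_iff₀ (by positivity), ← hcard]
      exact_mod_cast card_supersets_le k (x.1 ∪ L)
    refine (Finset.sum_le_card_nsmul _ _ _ h1).trans ?_
    have h2 : ((D \ supersets n j L).filter (fun x => x.1 ∩ L = I)).card ≤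
        (D ∩ supersets n j I).card := by
      refine Finset.card_le_card fun x hx => ?_
      rw [Finset.mem_filter, Finset.mem_sdiff] at hx
      rw [Finset.mem_inter, mem_supersets, ← hx.2]
      exact ⟨hx.1.1, Finset.inter_subset_left⟩
    have h3 : (((D \ supersets n j L).filter (fun x => x.1 ∩ L = I)).card : ℝ) ≤
        c * (n : ℝ) ^ (j - I.card) := le_trans (by exact_mod_cast h2) (hD I hIL)
    rw [nsmul_eq_mul]
    calc _ ≤ c * (n : ℝ) ^ (j - I.card) * ((n : ℝ) ^ k / (n : ℝ) ^ (j + L.card - I.card)) := by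
          gcongr
      _ = c * ((n : ℝ) ^ k / (n : ℝ) ^ L.card) := by
          rw [show j + L.card - I.card = (j - I.card) + L.card by omega, pow_add]
          field_simp
  refine (Finset.sum_le_card_nsmul _ _ _ hterm).trans ?_
  rw [nsmul_eq_mul]
  have hcard : L.ssubsets.card ≤ 2 ^ L.card := by
    rw [← Finset.card_powerset]
    exact Finset.card_le_card (Finset.erase_subset _ _)
  have : (L.ssubsets.card : ℝ) ≤ 2 ^ L.card := by exact_mod_cast hcard
  gcongr

/-! ### Degree bounds for a typical run -/

/-- The number of further `j`-sets in a `k`-set containing a given `j`-set. -/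
noncomputable def numOther (k j : ℕ) : ℝ := (k.choose j : ℝ) - 1

/-- The constant in the bound on the number of discovered `j`-sets. -/
noncomputable def baseConst (k j : ℕ) : ℝ := k.choose j * (4 * (k - j).factorial + 1)

/-- The factor by which the constant in the degree bound grows when the size of the set grows
by one. -/
noncomputable def growthConst (k j : ℕ) : ℝ :=
  2 * numOther k j * (32 * j.factorial + numOther k j +
    (numOther k j + 1) * (1 + 4 * (k - j).factorial * 2 ^ j))

/-- The constant in the degree bound for `ℓ`-sets. -/
noncomputable def degreeConst (k j ℓ : ℕ) : ℝ := baseConst k j * growthConst k j ^ ℓ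

/-- The slack: as `(1 + slack) ^ 2 * (B - 1) / B < 1` for `B = numOther k j`, the `j`-sets which
contain a given nonempty set generate fewer than one further such `j`-set each. -/
noncomputable def slack (k j : ℕ) : ℝ := 1 / (6 * numOther k j)

section Constants

variable {k j : ℕ}

theorem one_le_numOther (hj : 1 ≤ j) (hjk : j < k) : 1 ≤ numOther k j := by
  have h : 2 ≤ k.choose j := by
    obtain ⟨k, rfl⟩ : ∃ k', k = k' + 1 := ⟨k - 1, by omega⟩
    obtain ⟨j, rfl⟩ : ∃ j', j = j' + 1 := ⟨j - 1, by omega⟩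
    rw [Nat.choose_succ_succ']
    have h2 : 0 < k.choose (j + 1) := Nat.choose_pos (by omega)
    have h3 : 0 < k.choose j := Nat.choose_pos (by omega)
    omega
  have : (2 : ℝ) ≤ k.choose j := by exact_mod_cast h
  unfold numOther
  linarith

theorem one_le_baseConst (hjk : j < k) : 1 ≤ baseConst k j := by
  have h1 : (1 : ℝ) ≤ k.choose j := by exact_mod_cast Nat.choose_pos hjk.le
  have h2 : (1 : ℝ) ≤ 4 * (k - j).factorial + 1 := le_add_of_nonneg_left (by positivity)
  exact one_le_mul_of_one_le_of_one_le h1 h2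

theorem one_le_growthConst (hj : 1 ≤ j) (hjk : j < k) : 1 ≤ growthConst k j := by
  have h1 := one_le_numOther hj hjk
  unfold growthConst
  have h2 : (1 : ℝ) ≤ 32 * j.factorial + numOther k j +
      (numOther k j + 1) * (1 + 4 * (k - j).factorial * 2 ^ j) := by
    have : 0 ≤ (32 * j.factorial : ℝ) := by positivity
    have : 0 ≤ (numOther k j + 1) * (1 + 4 * (k - j).factorial * 2 ^ j) := by positivity
    linarith
  nlinarith

theorem one_le_degreeConst (hj : 1 ≤ j) (hjk : j < k) (ℓ : ℕ) : 1 ≤ degreeConst k j ℓ :=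
  one_le_mul_of_one_le_of_one_le (one_le_baseConst hjk) (one_le_pow₀ (one_le_growthConst hj hjk))

theorem degreeConst_mono (hj : 1 ≤ j) (hjk : j < k) : Monotone (degreeConst k j) :=
  fun _ _ h => mul_le_mul_of_nonneg_left (pow_le_pow_right₀ (one_le_growthConst hj hjk) h)
    (zero_le_one.trans (one_le_baseConst hjk))

theorem slack_pos (hj : 1 ≤ j) (hjk : j < k) : 0 < slack k j := by
  have := one_le_numOther hj hjk
  unfold slack
  positivity

theorem slack_le (hj : 1 ≤ j) (hjk : j < k) : slack k j ≤ 1 / 6 := by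
  have := one_le_numOther hj hjk
  unfold slack
  gcongr
  linarith

theorem slack_subcritical (hj : 1 ≤ j) (hjk : j < k) :
    (numOther k j - 1) * (1 + slack k j) ^ 2 ≤ numOther k j - 1 / 2 := by
  have hB := one_le_numOther hj hjk
  have h0 := slack_pos hj hjk
  have h1 := slack_le hj hjk
  have h2 : slack k j * numOther k j = 1 / 6 := by
    unfold slack
    field_simp
  nlinarith

end Constants

namespace SearchAlg

variable {n k j : ℕ} (alg : SearchAlg) (σ : Ranking (SetOfSize n k))
  (τ ρ : Ranking (SetOfSize n j)) (H : Set (SetOfSize n k))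

/-- The number of `j`-sets containing `L` which are discovered in the first `i` steps. -/
noncomputable def degreeAt (i : ℕ) (L : Finset (Fin n)) : ℕ :=
  (alg.discoveredAt (jSubsets n k j) σ τ ρ H i ∩ supersets n j L).card

/-- At all times, the number of edges found by the queries which are made in states belonging to `P`
exceeds `1 + slack` times the expected number by at most `a`. -/
def TypicalAnswers (p : ℝ) (a : ℝ) (P : Set (SearchState (SetOfSize n j) (SetOfSize n k))) :
    Prop :=
  ∀ i, (hits (alg.step (jSubsets n k j) σ τ ρ) (alg.query (jSubsets n k j) σ) P H
      (SearchState.init _ _) i : ℝ) ≤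
    a + (1 + slack k j) * (p * trials (alg.step (jSubsets n k j) σ τ ρ)
      (alg.query (jSubsets n k j) σ) P H (SearchState.init _ _) i)

/-- If degrees are small, then an explored `j`-set is the only discovered `j`-set in a constant
proportion of the `k`-sets containing it, and all these `k`-sets have been queried; so few `j`-sets
are explored when few `k`-sets have been queried. -/
theorem card_exploredAt_le (hj : 1 ≤ j) (hjk : j < k) (hn : 1 ≤ n) {α C : ℝ} (hα : 0 ≤ α)
    (hC : 0 ≤ C) (hαC : 2 ^ j * (C * α) ≤ 1 / (4 * (k - j).factorial))
    (hchoose : (n : ℝ) ^ (k - j) / (2 * (k - j).factorial) ≤ (n - j).choose (k - j)) (i : ℕ)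
    (hq : ((alg.run (jSubsets n k j) σ τ ρ H i).queried.card : ℝ) ≤ α * (n : ℝ) ^ k)
    (hdeg : ∀ I : Finset (Fin n), I.card < j →
      (alg.degreeAt σ τ ρ H i I : ℝ) ≤ C * α * (n : ℝ) ^ (j - I.card)) :
    ((alg.exploredAt (jSubsets n k j) σ τ ρ H i).card : ℝ) ≤
      4 * (k - j).factorial * (α * (n : ℝ) ^ j) := by
  have hn' : (0 : ℝ) < n := by exact_mod_cast hn
  have hf : (0 : ℝ) < (k - j).factorial := by exact_mod_cast Nat.factorial_pos _
  set D := alg.discoveredAt (jSubsets n k j) σ τ ρ H i with hD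
  have hpow : (n : ℝ) ^ k = (n : ℝ) ^ (k - j) * (n : ℝ) ^ j := by
    rw [← pow_add, Nat.sub_add_cancel hjk.le]
  have hu : ∀ v ∈ alg.exploredAt (jSubsets n k j) σ τ ρ H i,
      ∃ U : Finset (SetOfSize n k), ⌈(n : ℝ) ^ (k - j) / (4 * (k - j).factorial)⌉₊ ≤ U.card ∧
      ∀ e ∈ U, v ∈ jSubsets n k j e ∧ (∃ w ∈ jSubsets n k j e, w ≠ v) ∧
        ∀ w ∈ jSubsets n k j e, w ≠ v → w ∉ D := by
    intro v _
    refine ⟨Finset.univ.filter fun e => v ∈ jSubsets n k j e ∧ (∃ w ∈ jSubsets n k j e, w ≠ v) ∧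
        ∀ w ∈ jSubsets n k j e, w ≠ v → w ∉ D, ?_, fun e he => (Finset.mem_filter.1 he).2⟩
    have hsub : supersets n k v.1 ⊆
        (Finset.univ.filter fun e => v ∈ jSubsets n k j e ∧ (∃ w ∈ jSubsets n k j e, w ≠ v) ∧
          ∀ w ∈ jSubsets n k j e, w ≠ v → w ∉ D) ∪
        (D \ supersets n j v.1).biUnion fun x => supersets n k (x.1 ∪ v.1) := by
      intro e he
      rw [mem_supersets] at he
      rw [Finset.mem_union, Finset.mem_filter, Finset.mem_biUnion]
      by_cases hcon : ∃ w ∈ jSubsets n k j e, w ≠ v ∧ w ∈ D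
      · right
        obtain ⟨w, hwe, hwv, hwD⟩ := hcon
        refine ⟨w, Finset.mem_sdiff.2 ⟨hwD, fun h => hwv ?_⟩, ?_⟩
        · rw [mem_supersets] at h
          exact Subtype.ext (Finset.eq_of_subset_of_card_le h (by rw [w.2, v.2])).symm
        · rw [mem_supersets]
          exact Finset.union_subset (mem_jSubsets.1 hwe) he
      · left
        push Not at hcon
        refine ⟨Finset.mem_univ _, mem_jSubsets.2 he, ?_, hcon⟩
        refine Finset.exists_mem_ne ?_ v
        rw [card_jSubsets]
        have := one_le_numOther hj hjk
        unfold numOther at this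
        have : (1 : ℝ) < k.choose j := by linarith
        exact_mod_cast this
    have hcard := (Finset.card_le_card hsub).trans ((Finset.card_union_le _ _).trans
      (Nat.add_le_add_left Finset.card_biUnion_le _))
    rw [card_supersets (by rw [v.2]; exact hjk.le), v.2] at hcard
    have hsum := sum_card_supersets_union_le (k := k) hn D v.1 (C * α) (by positivity) v.2.le
      (fun I hI => hdeg I (by rw [← v.2]; exact Finset.card_lt_card hI))
    rw [v.2, hpow, mul_div_cancel_right₀ _ (by positivity), ← mul_assoc] at hsum
    have hcard' := (Nat.cast_le (α := ℝ)).2 hcard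
    push_cast at hcard'
    have h1 : 2 ^ j * (C * α) * (n : ℝ) ^ (k - j) ≤
        1 / (4 * (k - j).factorial) * (n : ℝ) ^ (k - j) :=
      mul_le_mul_of_nonneg_right hαC (by positivity)
    have h2 : (n : ℝ) ^ (k - j) / (2 * (k - j).factorial) =
        2 * (1 / (4 * (k - j).factorial) * (n : ℝ) ^ (k - j)) := by
      field_simp
      norm_num
    have h3 : (n : ℝ) ^ (k - j) / (4 * (k - j).factorial) =
        1 / (4 * (k - j).factorial) * (n : ℝ) ^ (k - j) := by
      field_simp
    rw [Nat.ceil_le]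
    linarith
  have hmul := alg.card_exploredAt_mul_le (jSubsets n k j) σ τ ρ H i _ hu
  have h1 : ((alg.exploredAt (jSubsets n k j) σ τ ρ H i).card : ℝ) *
      ((n : ℝ) ^ (k - j) / (4 * (k - j).factorial)) ≤ α * (n : ℝ) ^ k := by
    refine le_trans ?_ ((Nat.cast_le (α := ℝ).2 hmul).trans hq)
    push_cast
    gcongr
    exact Nat.le_ceil _
  rw [hpow, mul_div_assoc', div_le_iff₀ (by positivity)] at h1
  refine le_of_mul_le_mul_right (a := (n : ℝ) ^ (k - j)) ?_ (by positivity)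
  linarith

/-- The number of discovered `j`-sets is bounded in terms of the number of starts and queries. -/
theorem degreeAt_empty_le (hj : 1 ≤ j) (hjk : j < k) {α p : ℝ}
    (hα : 2 ≤ α * (n : ℝ)) (hp : 0 ≤ p) (hn : 1 ≤ n)
    (hpn : (1 + slack k j) * (p * (n : ℝ) ^ (k - j)) ≤ 4 * (k - j).factorial) (i : ℕ)
    (hq : ((alg.run (jSubsets n k j) σ τ ρ H i).queried.card : ℝ) ≤ α * (n : ℝ) ^ k)
    (hX : alg.TypicalAnswers σ τ ρ H p (α * n)
      (alg.currentIn _ (SetOfSize n k) (supersets n j ∅)))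
    (hstart : ((alg.startersAt (jSubsets n k j) σ τ ρ H i).card : ℝ) ≤
      (4 * (k - j).factorial + 1) * (α * (n : ℝ) ^ j)) :
    (alg.degreeAt σ τ ρ H i ∅ : ℝ) ≤ degreeConst k j 0 * α * (n : ℝ) ^ j := by
  have hn1 : (1 : ℝ) ≤ n := by exact_mod_cast hn
  have hα0 : 0 ≤ α := by
    by_contra hcon
    nlinarith
  have hs := slack_pos hj hjk
  have hB := one_le_numOther hj hjk
  have hpow : (n : ℝ) ^ k = (n : ℝ) ^ (k - j) * (n : ℝ) ^ j := by
    rw [← pow_add, Nat.sub_add_cancel hjk.le]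
  have hjump : hits (alg.step (jSubsets n k j) σ τ ρ) (alg.query (jSubsets n k j) σ)
      (alg.jumpInto (jSubsets n k j) σ (supersets n j ∅)) H
      (SearchState.init (SetOfSize n j) (SetOfSize n k)) i = 0 := by
    have : alg.jumpInto (jSubsets n k j) σ (supersets n j ∅) = ∅ := by
      ext s
      simp [jumpInto]
    simp [hits, this]
  have hdeg := alg.card_discoveredAt_inter_le (jSubsets n k j) σ τ ρ H (supersets n j ∅)
    (k.choose j - 1) (k.choose j)
    (fun e x _ _ => (card_jSubsets_inter_le e _).trans (by omega))
    (fun e => card_jSubsets_inter_le e _) i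
  rw [hjump, mul_zero, add_zero] at hdeg
  have hdeg' := (Nat.cast_le (α := ℝ)).2 hdeg
  have hch : ((k.choose j - 1 : ℕ) : ℝ) = numOther k j := by
    rw [Nat.cast_sub (Nat.choose_pos hjk.le)]
    simp [numOther]
  push_cast at hdeg'
  rw [hch] at hdeg'
  have hS : ((alg.startersAt (jSubsets n k j) σ τ ρ H i ∩ supersets n j ∅).card : ℝ) ≤
      (4 * (k - j).factorial + 1) * (α * (n : ℝ) ^ j) :=
    le_trans (by exact_mod_cast Finset.card_le_card Finset.inter_subset_left) hstart
  have hhits : (hits (alg.step (jSubsets n k j) σ τ ρ) (alg.query (jSubsets n k j) σ)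
      (alg.currentIn _ (SetOfSize n k) (supersets n j ∅)) H
      (SearchState.init (SetOfSize n j) (SetOfSize n k)) i : ℝ) ≤
      (4 * (k - j).factorial + 1) * (α * (n : ℝ) ^ j) := by
    have htr : (trials (alg.step (jSubsets n k j) σ τ ρ) (alg.query (jSubsets n k j) σ)
        (alg.currentIn _ (SetOfSize n k) (supersets n j ∅)) H
        (SearchState.init (SetOfSize n j) (SetOfSize n k)) i : ℝ) ≤ α * (n : ℝ) ^ k :=
      le_trans (by exact_mod_cast alg.trials_le_card_queried (jSubsets n k j) σ τ ρ H _ i) hq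
    refine (hX i).trans ?_
    calc _ ≤ α * (n : ℝ) ^ j + (1 + slack k j) * (p * (α * (n : ℝ) ^ k)) := by
          gcongr
          exact le_self_pow₀ hn1 (by omega)
      _ = α * (n : ℝ) ^ j + (1 + slack k j) * (p * (n : ℝ) ^ (k - j)) * (α * (n : ℝ) ^ j) := by
          rw [hpow]; ring
      _ ≤ α * (n : ℝ) ^ j + 4 * (k - j).factorial * (α * (n : ℝ) ^ j) := by gcongr
      _ = _ := by ring
  refine (hdeg'.trans (add_le_add hS (mul_le_mul_of_nonneg_left hhits (by linarith)))).trans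
    (le_of_eq ?_)
  simp only [degreeConst, baseConst, numOther, pow_zero]
  ring

/-- The recursion for the degrees: a `j`-set containing a nonempty set `L` is a starting vertex, or
it is discovered from a `j`-set containing `L`, which accounts for less than a constant
proportion `< 1` of the degree, or from one that does not contain `L`, which is controlled by the
degrees of the proper subsets of `L`. -/
theorem degreeAt_le_of_ssubset (hj : 1 ≤ j) (hjk : j < k) {α p : ℝ} (hn : 1 ≤ n)
    (hα : 0 ≤ α) (hp : 0 ≤ p)
    (hpn : p * (n : ℝ) ^ (k - j) ≤ (1 + slack k j) * ((k - j).factorial / numOther k j))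
    (i ℓ : ℕ) (hℓ : ℓ + 1 < j) (L : Finset (Fin n)) (hL : L.card = ℓ + 1)
    (hX : alg.TypicalAnswers σ τ ρ H p (α * n)
      (alg.currentIn _ (SetOfSize n k) (supersets n j L)))
    (hY : alg.TypicalAnswers σ τ ρ H p (α * n)
      (alg.jumpInto (jSubsets n k j) σ (supersets n j L)))
    (hstart : ((alg.startersAt (jSubsets n k j) σ τ ρ H i ∩ supersets n j L).card : ℝ) ≤
      32 * j.factorial * (baseConst k j * (α * (n : ℝ) ^ (j - L.card))))
    (hdeg : ∀ I ⊂ L, (alg.degreeAt σ τ ρ H i I : ℝ) ≤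
      degreeConst k j ℓ * α * (n : ℝ) ^ (j - I.card)) :
    (alg.degreeAt σ τ ρ H i L : ℝ) ≤ degreeConst k j (ℓ + 1) * α * (n : ℝ) ^ (j - L.card) := by
  have hn1 : (1 : ℝ) ≤ n := by exact_mod_cast hn
  have hs := slack_pos hj hjk
  have hs1 := slack_le hj hjk
  have hsub := slack_subcritical hj hjk
  have hB := one_le_numOther hj hjk
  have hf : (0 : ℝ) < (k - j).factorial := by exact_mod_cast Nat.factorial_pos _
  have hc1 := one_le_degreeConst hj hjk ℓ
  have hbase : baseConst k j ≤ degreeConst k j ℓ := by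
    have := degreeConst_mono hj hjk (Nat.zero_le ℓ)
    simpa [degreeConst] using this
  set B := numOther k j with hBdef
  set θ := slack k j
  set c := degreeConst k j ℓ
  set N := α * (n : ℝ) ^ (j - L.card) with hN
  have hN0 : 0 ≤ N := by positivity
  have hαN : α * n ≤ N := by
    rw [hN]
    gcongr
    exact le_self_pow₀ hn1 (by omega)
  have hpow : (n : ℝ) ^ k / (n : ℝ) ^ L.card = (n : ℝ) ^ (k - j) * (n : ℝ) ^ (j - L.card) := by
    rw [div_eq_iff (by positivity), ← pow_add, ← pow_add]
    congr 1
    omega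
  have hch : ((k.choose j - 2 : ℕ) : ℝ) = B - 1 := by
    have : 2 ≤ k.choose j := by
      rw [hBdef, numOther] at hB
      have : (2 : ℝ) ≤ k.choose j := by linarith
      exact_mod_cast this
    rw [Nat.cast_sub this, hBdef, numOther]
    push_cast
    ring
  have hch' : (k.choose j : ℝ) = B + 1 := by rw [hBdef, numOther]; ring
  have hD := alg.card_discoveredAt_inter_le (jSubsets n k j) σ τ ρ H (supersets n j L)
    (k.choose j - 2) (k.choose j)
    (fun e x hx hxe => card_jSubsets_inter_supersets_le hjk hj (by omega) (by omega) hx hxe)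
    (fun e => card_jSubsets_inter_le e _) i
  have hD' := (Nat.cast_le (α := ℝ)).2 hD
  push_cast at hD'
  rw [hch, hch'] at hD'
  change (alg.degreeAt σ τ ρ H i L : ℝ) ≤ _ at hD'
  set D := (alg.degreeAt σ τ ρ H i L : ℝ) with hDdef
  have hD0 : 0 ≤ D := Nat.cast_nonneg _
  -- queries from within
  have hin : (B - 1) * hits (alg.step (jSubsets n k j) σ τ ρ) (alg.query (jSubsets n k j) σ)
      (alg.currentIn _ (SetOfSize n k) (supersets n j L)) H
      (SearchState.init (SetOfSize n j) (SetOfSize n k)) i ≤ B * N + (1 - 1 / (2 * B)) * D := by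
    have htr : (trials (alg.step (jSubsets n k j) σ τ ρ) (alg.query (jSubsets n k j) σ)
        (alg.currentIn _ (SetOfSize n k) (supersets n j L)) H
        (SearchState.init (SetOfSize n j) (SetOfSize n k)) i : ℝ) ≤
        D * ((n : ℝ) ^ (k - j) / (k - j).factorial) := by
      have h1 := alg.trials_currentIn_le (jSubsets n k j) σ τ ρ H (supersets n j L) i
        ((n - j).choose (k - j)) (fun x => supersets n k x.1)
        (fun x e hxe => mem_supersets.2 (mem_jSubsets.1 hxe))
        (fun x _ => by rw [card_supersets (by rw [x.2]; exact hjk.le), x.2])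
      refine ((Nat.cast_le (α := ℝ)).2 h1).trans ?_
      push_cast
      refine mul_le_mul_of_nonneg_left ?_ hD0
      refine (Nat.choose_le_pow_div (k - j) (n - j)).trans ?_
      gcongr
      exact_mod_cast Nat.sub_le n j
    have h1 : (1 + θ) * (p * (D * ((n : ℝ) ^ (k - j) / (k - j).factorial))) ≤
        (1 + θ) ^ 2 / B * D := by
      calc _ = (1 + θ) * (p * (n : ℝ) ^ (k - j)) * (D / (k - j).factorial) := by
            ring
        _ ≤ (1 + θ) * ((1 + θ) * ((k - j).factorial / B)) * (D / (k - j).factorial) := by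
            gcongr
        _ = (1 + θ) ^ 2 / B * D := by
            field_simp
    calc _ ≤ (B - 1) * (N + (1 + θ) ^ 2 / B * D) := by
          refine mul_le_mul_of_nonneg_left ((hX i).trans ?_) (by linarith)
          refine add_le_add hαN (le_trans ?_ h1)
          gcongr
      _ = (B - 1) * N + ((B - 1) * (1 + θ) ^ 2) / B * D := by ring
      _ ≤ B * N + (B - 1 / 2) / B * D := by
          gcongr
          linarith
      _ = _ := by
          field_simp
  -- queries from outside
  have hout : (hits (alg.step (jSubsets n k j) σ τ ρ) (alg.query (jSubsets n k j) σ)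
      (alg.jumpInto (jSubsets n k j) σ (supersets n j L)) H
      (SearchState.init (SetOfSize n j) (SetOfSize n k)) i : ℝ) ≤
      (1 + 4 * (k - j).factorial * 2 ^ j) * (c * N) := by
    have htr : (trials (alg.step (jSubsets n k j) σ τ ρ) (alg.query (jSubsets n k j) σ)
        (alg.jumpInto (jSubsets n k j) σ (supersets n j L)) H
        (SearchState.init (SetOfSize n j) (SetOfSize n k)) i : ℝ) ≤
        2 ^ j * (c * ((n : ℝ) ^ (k - j) * N)) := by
      have h1 := alg.trials_jumpInto_le (jSubsets n k j) σ τ ρ H (supersets n j L) i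
        (fun x => supersets n k (x.1 ∪ L)) (fun x e hxe ⟨v, hve, hLv⟩ => by
          rw [mem_supersets] at hLv ⊢
          exact Finset.union_subset (mem_jSubsets.1 hxe) (hLv.trans (mem_jSubsets.1 hve)))
      refine ((Nat.cast_le (α := ℝ)).2 h1).trans ?_
      push_cast
      have h2 := sum_card_supersets_union_le (k := k) hn
        (alg.discoveredAt (jSubsets n k j) σ τ ρ H i) L (c * α) (by positivity) (by omega) hdeg
      calc _ ≤ _ := h2
        _ ≤ 2 ^ j * (c * α * ((n : ℝ) ^ k / (n : ℝ) ^ L.card)) := by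
            gcongr
            · norm_num
            · omega
        _ = _ := by rw [hpow, hN]; ring
    have h4 : (1 + θ) * (p * (n : ℝ) ^ (k - j)) ≤ 4 * (k - j).factorial := by
      have h5 : ((k - j).factorial : ℝ) / B ≤ (k - j).factorial :=
        div_le_self hf.le hB
      calc _ ≤ (1 + θ) * ((1 + θ) * ((k - j).factorial / B)) := by gcongr
        _ ≤ 2 * (2 * (k - j).factorial) := by gcongr <;> linarith
        _ = _ := by ring
    calc _ ≤ N + (1 + θ) * (p * (2 ^ j * (c * ((n : ℝ) ^ (k - j) * N)))) := by
          refine (hY i).trans (add_le_add hαN ?_)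
          gcongr
      _ = N + (1 + θ) * (p * (n : ℝ) ^ (k - j)) * (2 ^ j * (c * N)) := by ring
      _ ≤ c * N + 4 * (k - j).factorial * (2 ^ j * (c * N)) := by
          gcongr
          exact le_mul_of_one_le_left hN0 hc1
      _ = _ := by ring
  have hstart' : ((alg.startersAt (jSubsets n k j) σ τ ρ H i ∩ supersets n j L).card : ℝ) ≤
      32 * j.factorial * (c * N) := hstart.trans (by gcongr)
  have hNc : B * N ≤ B * (c * N) := by
    gcongr
    exact le_mul_of_one_le_left hN0 hc1
  have hfinal : D / (2 * B) ≤ (32 * j.factorial + B +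
      (B + 1) * (1 + 4 * (k - j).factorial * 2 ^ j)) * (c * N) := by
    have h1 : (B + 1) * (hits (alg.step (jSubsets n k j) σ τ ρ) (alg.query (jSubsets n k j) σ)
      (alg.jumpInto (jSubsets n k j) σ (supersets n j L)) H
      (SearchState.init (SetOfSize n j) (SetOfSize n k)) i : ℝ) ≤
      (B + 1) * ((1 + 4 * (k - j).factorial * 2 ^ j) * (c * N)) := by gcongr
    have h2 : D / (2 * B) = D - (1 - 1 / (2 * B)) * D := by ring
    rw [h2]
    linarith
  rw [div_le_iff₀ (by positivity)] at hfinal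
  refine hfinal.trans (le_of_eq ?_)
  simp only [c, degreeConst, growthConst, pow_succ, hN]
  ring

end SearchAlg

namespace SearchAlg

variable {n k j : ℕ} (alg : SearchAlg) (σ : Ranking (SetOfSize n k))
  (τ ρ : Ranking (SetOfSize n j)) (H : Set (SetOfSize n k))

/-- The ordering `τ` has few `j`-sets containing `L`, up to a constant factor no more than on average,
among the first ones, from which the starting vertices are taken. -/
def TypicalRanking (τ : Ranking (SetOfSize n j)) (k : ℕ) (α : ℝ) (L : Finset (Fin n)) : Prop :=
  (({v ∈ supersets n j L | (τ v : ℕ) < ⌊baseConst k j * (α * (n : ℝ) ^ j)⌋₊ + 1} :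
    Finset (SetOfSize n j)).card : ℝ) ≤
      32 * j.factorial * (baseConst k j * (α * (n : ℝ) ^ (j - L.card)))

/-- The degree bounds hold throughout a typical run. The bounds at one moment limit the number of
explored, hence of starting `j`-sets at the next moment, and the bounds at that moment follow by
induction on the size of the set. -/
theorem degreeAt_le (hj : 1 ≤ j) (hjk : j < k) {α p : ℝ} (hn : 1 ≤ n)
    (hα : 2 ≤ α * (n : ℝ)) (hp : 0 ≤ p)
    (hpn : p * (n : ℝ) ^ (k - j) ≤ (1 + slack k j) * ((k - j).factorial / numOther k j))
    (hαC : 2 ^ j * (degreeConst k j j * α) ≤ 1 / (4 * (k - j).factorial))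
    (hchoose : (n : ℝ) ^ (k - j) / (2 * (k - j).factorial) ≤ (n - j).choose (k - j))
    (hX : ∀ L : Finset (Fin n), L.card < j → alg.TypicalAnswers σ τ ρ H p (α * n)
      (alg.currentIn _ (SetOfSize n k) (supersets n j L)))
    (hY : ∀ L : Finset (Fin n), L.card < j → alg.TypicalAnswers σ τ ρ H p (α * n)
      (alg.jumpInto (jSubsets n k j) σ (supersets n j L)))
    (hτ : ∀ L : Finset (Fin n), L.card < j → TypicalRanking τ k α L) (i : ℕ) :
    ((alg.run (jSubsets n k j) σ τ ρ H i).queried.card : ℝ) ≤ α * (n : ℝ) ^ k →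
      ∀ L : Finset (Fin n), L.card < j →
        (alg.degreeAt σ τ ρ H i L : ℝ) ≤ degreeConst k j L.card * α * (n : ℝ) ^ (j - L.card) := by
  have hn1 : (1 : ℝ) ≤ n := by exact_mod_cast hn
  have hα0 : 0 ≤ α := by
    by_contra hcon
    nlinarith
  have hs := slack_pos hj hjk
  have hs1 := slack_le hj hjk
  have hB := one_le_numOther hj hjk
  have hf : (0 : ℝ) < (k - j).factorial := by exact_mod_cast Nat.factorial_pos _
  have hpn' : (1 + slack k j) * (p * (n : ℝ) ^ (k - j)) ≤ 4 * (k - j).factorial := by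
    have h5 : ((k - j).factorial : ℝ) / numOther k j ≤ (k - j).factorial :=
      div_le_self hf.le hB
    calc _ ≤ (1 + slack k j) * ((1 + slack k j) * ((k - j).factorial / numOther k j)) := by gcongr
      _ ≤ 2 * (2 * (k - j).factorial) := by gcongr <;> linarith
      _ = _ := by ring
  have hαj : 2 ≤ α * (n : ℝ) ^ j := hα.trans (by gcongr; exact le_self_pow₀ hn1 (by omega))
  induction i with
  | zero =>
    intro _ L _
    have h0 : alg.degreeAt σ τ ρ H 0 L = 0 := by
      simp [degreeAt, discoveredAt, run, SearchState.init]
    have := one_le_degreeConst hj hjk L.card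
    rw [h0, Nat.cast_zero]
    positivity
  | succ i ih =>
    intro hq
    have hq' : ((alg.run (jSubsets n k j) σ τ ρ H i).queried.card : ℝ) ≤ α * (n : ℝ) ^ k :=
      le_trans (by exact_mod_cast
        alg.card_queried_run_mono (jSubsets n k j) σ τ ρ H (Nat.le_succ i)) hq
    have hexp := alg.card_exploredAt_le σ τ ρ H hj hjk hn hα0
      (zero_le_one.trans (one_le_degreeConst hj hjk j)) hαC hchoose i hq' fun I hI =>
        (ih hq' I hI).trans (by gcongr; exact degreeConst_mono hj hjk hI.le)
    have hstart : ((alg.startersAt (jSubsets n k j) σ τ ρ H (i + 1)).card : ℝ) ≤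
        (4 * (k - j).factorial + 1) * (α * (n : ℝ) ^ j) := by
      have h1 := (alg.card_startersAt_succ_le (jSubsets n k j) σ τ ρ H i).trans
        (Nat.add_le_add_right (alg.card_startersAt_le (jSubsets n k j) σ τ ρ H i) 1)
      have h2 := (Nat.cast_le (α := ℝ)).2 h1
      push_cast at h2
      linarith
    have hempty := alg.degreeAt_empty_le σ τ ρ H hj hjk hα hp hn hpn' (i + 1) hq
      (hX ∅ (by simp; omega)) hstart
    have hstartL : ∀ L : Finset (Fin n), L.card < j →
        ((alg.startersAt (jSubsets n k j) σ τ ρ H (i + 1) ∩ supersets n j L).card : ℝ) ≤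
          32 * j.factorial * (baseConst k j * (α * (n : ℝ) ^ (j - L.card))) := by
      intro L hL
      refine le_trans ?_ (hτ L hL)
      refine Nat.cast_le.2 (Finset.card_le_card fun v hv => ?_)
      rw [Finset.mem_inter] at hv
      refine Finset.mem_filter.2 ⟨hv.2, Nat.lt_succ_of_le ?_⟩
      refine (alg.rank_le_of_mem_startersAt (jSubsets n k j) σ τ ρ H hv.1).trans (Nat.le_floor ?_)
      have h1 : alg.discoveredAt (jSubsets n k j) σ τ ρ H (i + 1) =
          alg.discoveredAt (jSubsets n k j) σ τ ρ H (i + 1) ∩ supersets n j ∅ :=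
        (Finset.inter_eq_left.2 fun J _ => by simp).symm
      rw [h1]
      refine hempty.trans (le_of_eq ?_)
      rw [degreeConst, pow_zero]
      ring
    suffices ∀ ℓ, ∀ L : Finset (Fin n), L.card = ℓ → ℓ < j →
        (alg.degreeAt σ τ ρ H (i + 1) L : ℝ) ≤
          degreeConst k j L.card * α * (n : ℝ) ^ (j - L.card) from
      fun L hL => this L.card L rfl hL
    intro ℓ
    induction ℓ using Nat.strong_induction_on with
    | _ ℓ ihℓ =>
      intro L hL hℓ
      rcases ℓ with _ | ℓ
      · obtain rfl := Finset.card_eq_zero.1 hL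
        simpa using hempty
      · have := alg.degreeAt_le_of_ssubset σ τ ρ H hj hjk hn hα0 hp hpn (i + 1) ℓ hℓ L hL
          (hX L (by omega)) (hY L (by omega)) (hstartL L (by omega)) fun I hI => by
            have hIL := Finset.card_lt_card hI
            refine (ihℓ I.card (by omega) I rfl (by omega)).trans ?_
            gcongr
            exact degreeConst_mono hj hjk (by omega)
        rwa [hL] at this ⊢

/-- All discoveries up to a given time are made at a single moment. -/
theorem setDegree_discovered_le (t c : ℝ) (hc : 0 ≤ c) (L : Finset (Fin n))
    (h : ∀ i, ((alg.run (jSubsets n k j) σ τ ρ H i).queried.card : ℝ) ≤ t →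
      (alg.degreeAt σ τ ρ H i L : ℝ) ≤ c) :
    (setDegree (discoveredJSets alg σ τ ρ H t) L : ℝ) ≤ c := by
  classical
  set G : Finset (SetOfSize n j) := {J ∈ discoveredJSets alg σ τ ρ H t | L ⊆ J.1}.toFinset with hG
  have hGmem : ∀ J, J ∈ G ↔ (∃ i, ((alg.run (jSubsets n k j) σ τ ρ H i).queried.card : ℝ) ≤ t ∧
      (alg.run (jSubsets n k j) σ τ ρ H i).status J ≠ .neutral) ∧ L ⊆ J.1 := by
    intro J
    rw [hG, Set.mem_toFinset]
    rfl
  have hdeg : setDegree (discoveredJSets alg σ τ ρ H t) L = G.card := by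
    rw [setDegree, Set.ncard_eq_toFinset_card']
  rw [hdeg]
  rcases G.eq_empty_or_nonempty with hemp | hne
  · simpa [hemp] using hc
  have hex : ∀ J ∈ G, ∃ i, ((alg.run (jSubsets n k j) σ τ ρ H i).queried.card : ℝ) ≤ t ∧
      (alg.run (jSubsets n k j) σ τ ρ H i).status J ≠ .neutral := fun J hJ => ((hGmem J).1 hJ).1
  choose! f hf hf' using hex
  obtain ⟨J₀, hJ₀, hmax⟩ := G.exists_max_image f hne
  refine le_trans ?_ (h (f J₀) (hf J₀ hJ₀))
  refine Nat.cast_le.2 (Finset.card_le_card fun J hJ => ?_)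
  rw [Finset.mem_inter, mem_supersets]
  exact ⟨discoveredAt_mono alg (jSubsets n k j) σ τ ρ H (hmax J hJ)
    (mem_discoveredAt.2 (hf' J hJ)), ((hGmem J).1 hJ).2⟩

/-! ### Probability of a typical run -/

theorem real_not_typicalAnswers_le (hj : 1 ≤ j) (hjk : j < k) (p : unitInterval) (a : ℝ)
    (P : Set (SearchState (SetOfSize n j) (SetOfSize n k))) :
    (setBernoulli (Set.univ : Set (SetOfSize n k)) p).real
      {H | ¬ alg.TypicalAnswers σ τ ρ H p a P} ≤ Real.exp (-(slack k j * a)) := by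
  have hs := slack_pos hj hjk
  have hs1 := slack_le hj hjk
  refine (measureReal_mono ?_ (measure_ne_top _ _)).trans
    ((alg.isAdaptiveQuery (jSubsets n k j) σ τ ρ).real_exists_le' p P (slack k j)
      (SearchState.init _ _) (slack k j * a))
  intro H hH
  simp only [TypicalAnswers, Set.mem_ofPred_eq, not_forall, not_le] at hH ⊢
  obtain ⟨i, hi⟩ := hH
  refine ⟨i, ?_⟩
  set X := (hits (alg.step (jSubsets n k j) σ τ ρ) (alg.query (jSubsets n k j) σ) P H
      (SearchState.init _ _) i : ℝ)
  set Q := (trials (alg.step (jSubsets n k j) σ τ ρ) (alg.query (jSubsets n k j) σ) P H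
      (SearchState.init _ _) i : ℝ) with hQ
  have hQ0 : 0 ≤ Q := Nat.cast_nonneg _
  have hexp : Real.exp (slack k j) - 1 ≤ slack k j * (1 + slack k j) := by
    have := (abs_le.1 (Real.abs_exp_sub_one_sub_id_le (x := slack k j)
      (by rw [abs_of_pos hs]; linarith))).2
    nlinarith
  have h1 : p * (Real.exp (slack k j) - 1) * Q ≤ p * (slack k j * (1 + slack k j)) * Q := by
    have := p.2.1
    gcongr
  have h2 := mul_le_mul_of_nonneg_left hi.le hs.le
  linarith

theorem real_not_typicalRanking_le (hj : 1 ≤ j) (hjk : j < k) {α : ℝ} (hn : 1 ≤ n)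
    (hα : 2 ≤ α * (n : ℝ)) (hchoose : (n : ℝ) ^ j / (2 * j.factorial) ≤ n.choose j)
    (L : Finset (Fin n)) (hL : L.card < j) :
    (uniformOn (Set.univ : Set (Ranking (SetOfSize n j)))).real
      {τ | ¬ TypicalRanking τ k α L} ≤ Real.exp (-(α * n)) := by
  classical
  have hn1 : (1 : ℝ) ≤ n := by exact_mod_cast hn
  have hα0 : 0 ≤ α := by
    by_contra hcon
    nlinarith
  have hjf : (1 : ℝ) ≤ j.factorial := by exact_mod_cast Nat.factorial_pos _
  have hC0 := one_le_baseConst hjk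
  have hαj : 2 ≤ α * (n : ℝ) ^ j := hα.trans (by gcongr; exact le_self_pow₀ hn1 (by omega))
  have hcard : Fintype.card (SetOfSize n j) = n.choose j := by simp
  have hne : Nonempty (SetOfSize n j) := by
    rw [← Fintype.card_pos_iff, hcard]
    have : (0 : ℝ) < n.choose j := lt_of_lt_of_le (by positivity) hchoose
    exact_mod_cast this
  set y := baseConst k j * (α * (n : ℝ) ^ (j - L.card)) with hy
  set x := baseConst k j * (α * (n : ℝ) ^ j) with hx
  have hx1 : 1 ≤ x := by rw [hx]; nlinarith
  have hyα : α * n ≤ y := by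
    calc α * n ≤ α * (n : ℝ) ^ (j - L.card) := by
          gcongr
          exact le_self_pow₀ hn1 (by omega)
      _ ≤ y := le_mul_of_one_le_left (by positivity) hC0
  have hF : ((supersets n j L).card : ℝ) ≤ (n : ℝ) ^ (j - L.card) := by
    have h1 : ((supersets n j L).card : ℝ) * (n : ℝ) ^ L.card ≤ (n : ℝ) ^ j := by
      exact_mod_cast card_supersets_le j L
    rw [← Nat.sub_add_cancel hL.le, pow_add] at h1
    rw [Nat.sub_add_cancel hL.le] at h1
    exact le_of_mul_le_mul_right h1 (by positivity)
  have hexp : Real.exp 2 ≤ 8 := by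
    have h1 := Real.exp_one_lt_d9
    have h2 : Real.exp 2 = Real.exp 1 * Real.exp 1 := by rw [← Real.exp_add]; norm_num
    rw [h2]
    nlinarith [Real.exp_pos 1]
  have hr : Real.exp 2 * ((supersets n j L).card * ((⌊x⌋₊ + 1 : ℕ) : ℝ)) ≤
      (⌈32 * j.factorial * y⌉₊ : ℝ) * Fintype.card (SetOfSize n j) := by
    rw [hcard]
    calc _ ≤ 8 * ((n : ℝ) ^ (j - L.card) * (2 * x)) := by
          gcongr
          push_cast
          linarith [Nat.floor_le (zero_le_one.trans hx1)]
      _ = 32 * j.factorial * y * ((n : ℝ) ^ j / (2 * j.factorial)) := by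
          rw [hx, hy]
          field_simp
          ring
      _ ≤ _ := by
          gcongr
          exact Nat.le_ceil _
  refine (measureReal_mono ?_ (measure_ne_top _ _)).trans
    ((uniformOn_real_card_filter_le _ _ _ hr).trans ?_)
  · intro τ hτ
    simp only [TypicalRanking, Set.mem_ofPred_eq, not_le] at hτ ⊢
    rw [Nat.ceil_le]
    refine hτ.le.trans (Nat.cast_le.2 (Finset.card_le_card fun v hv => ?_))
    simpa using hv
  · gcongr
    refine le_trans ?_ (Nat.le_ceil _)
    nlinarith

/-- The degree bound for a given `n`, under explicit conditions on `n`, `p` and `α`. -/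
theorem real_degree_bound_ge (hj : 1 ≤ j) (hjk : j < k) {α : ℝ} (hn : 1 ≤ n)
    (hα : 2 ≤ α * (n : ℝ)) (p : unitInterval)
    (hpn : p * (n : ℝ) ^ (k - j) ≤ (1 + slack k j) * ((k - j).factorial / numOther k j))
    (hαC : 2 ^ j * (degreeConst k j j * α) ≤ 1 / (4 * (k - j).factorial))
    (hchoose : (n : ℝ) ^ (k - j) / (2 * (k - j).factorial) ≤ (n - j).choose (k - j))
    (hchoose' : (n : ℝ) ^ j / (2 * j.factorial) ≤ n.choose j)
    (ρ : Ranking (SetOfSize n j) → Ranking (SetOfSize n j)) :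
    1 - 3 * (j * (n : ℝ) ^ j) * Real.exp (-(slack k j * (α * n))) ≤
      (searchLaw n k j p).real
        {ω | ∀ ℓ : ℕ, ℓ ≤ j - 1 → ∀ L : Finset (Fin n), L.card = ℓ →
          (setDegree (discoveredJSets alg σ ω.1 (ρ ω.1) ω.2 (α * (n : ℝ) ^ k)) L : ℝ)
            ≤ degreeConst k j j * α * (n : ℝ) ^ (j - ℓ)} := by
  classical
  have hn1 : (1 : ℝ) ≤ n := by exact_mod_cast hn
  have hα0 : 0 ≤ α := by
    by_contra hcon
    nlinarith
  have hs := slack_pos hj hjk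
  have hs1 := slack_le hj hjk
  set small : Finset (Finset (Fin n)) := Finset.univ.filter fun L => L.card < j with hsmall
  have hsmallcard : (small.card : ℝ) ≤ j * (n : ℝ) ^ j := by
    have h1 : small = (Finset.range j).biUnion fun ℓ => Finset.univ.powersetCard ℓ := by
      ext L
      simp [hsmall]
    have h2 : small.card ≤ j * n ^ j := by
      rw [h1]
      refine (Finset.card_biUnion_le_card_mul _ _ (n ^ j) fun ℓ hℓ => ?_).trans (by simp)
      rw [Finset.card_powersetCard, Finset.card_univ, Fintype.card_fin]
      exact (Nat.choose_le_pow _ _).trans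
        (Nat.pow_le_pow_right hn (Finset.mem_range.1 hℓ).le)
    exact_mod_cast h2
  set e := Real.exp (-(slack k j * (α * n))) with he
  -- atypical orderings
  set A : Set (Ranking (SetOfSize n j)) := ⋃ L ∈ small, {τ | ¬ TypicalRanking τ k α L} with hA
  have hAle : (uniformOn (Set.univ : Set (Ranking (SetOfSize n j)))).real A ≤
      small.card * e := by
    refine (measureReal_biUnion_finset_le _ _).trans ?_
    rw [← nsmul_eq_mul]
    refine Finset.sum_le_card_nsmul _ _ _ fun L hL => ?_
    refine (real_not_typicalRanking_le hj hjk hn hα hchoose' L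
      (by simpa [hsmall] using hL)).trans ?_
    rw [he]
    refine Real.exp_le_exp.2 (neg_le_neg (mul_le_of_le_one_left (by positivity) (by linarith)))
  -- atypical answers, for a given ordering
  set N : Ranking (SetOfSize n j) → Set (Set (SetOfSize n k)) := fun τ =>
    ⋃ L ∈ small, ({H | ¬ alg.TypicalAnswers σ τ (ρ τ) H p (α * n)
        (alg.currentIn _ (SetOfSize n k) (supersets n j L))} ∪
      {H | ¬ alg.TypicalAnswers σ τ (ρ τ) H p (α * n)
        (alg.jumpInto (jSubsets n k j) σ (supersets n j L))}) with hN
  have hNle : ∀ τ, (setBernoulli (Set.univ : Set (SetOfSize n k)) p).real (N τ) ≤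
      small.card * (2 * e) := by
    intro τ
    refine (measureReal_biUnion_finset_le _ _).trans ?_
    rw [← nsmul_eq_mul]
    refine Finset.sum_le_card_nsmul _ _ _ fun L _ => ?_
    refine (measureReal_union_le _ _).trans ?_
    rw [two_mul]
    exact add_le_add (alg.real_not_typicalAnswers_le σ τ (ρ τ) hj hjk p _ _)
      (alg.real_not_typicalAnswers_le σ τ (ρ τ) hj hjk p _ _)
  have hprob : IsProbabilityMeasure (searchLaw n k j p) := by
    unfold searchLaw
    infer_instance
  have hbadA : (searchLaw n k j p).real (A ×ˢ Set.univ) ≤ small.card * e := by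
    rw [searchLaw, measureReal_prod_prod]
    simpa using hAle
  have hbadN : (searchLaw n k j p).real {ω | ω.2 ∈ N ω.1} ≤ small.card * (2 * e) := by
    rw [measureReal_def]
    refine ENNReal.toReal_le_of_le_ofReal (by positivity) ?_
    rw [searchLaw, Measure.prod_apply MeasurableSet.of_discrete]
    refine (lintegral_mono (g := fun _ => ENNReal.ofReal (small.card * (2 * e))) fun τ => ?_).trans
      (by simp)
    rw [← ofReal_measureReal]
    exact ENNReal.ofReal_le_ofReal (hNle τ)
  have hgood : (A ×ˢ Set.univ ∪ {ω : Ranking (SetOfSize n j) × Set (SetOfSize n k) |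
      ω.2 ∈ N ω.1})ᶜ ⊆
      {ω | ∀ ℓ : ℕ, ℓ ≤ j - 1 → ∀ L : Finset (Fin n), L.card = ℓ →
          (setDegree (discoveredJSets alg σ ω.1 (ρ ω.1) ω.2 (α * (n : ℝ) ^ k)) L : ℝ)
            ≤ degreeConst k j j * α * (n : ℝ) ^ (j - ℓ)} := by
    rintro ⟨τ, H⟩ hω ℓ hℓ L rfl
    simp only [Set.compl_union, Set.mem_inter_iff, Set.mem_compl_iff, Set.mem_prod, Set.mem_univ,
      and_true, Set.mem_ofPred_eq, hA, hN, Set.mem_iUnion, Set.mem_union, not_exists,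
      not_or, not_not, hsmall, Finset.mem_filter, Finset.mem_univ, true_and] at hω
    have hC := one_le_degreeConst hj hjk j
    refine alg.setDegree_discovered_le σ τ (ρ τ) H _ _ (by positivity) L fun i hi => ?_
    refine (alg.degreeAt_le σ τ (ρ τ) H hj hjk hn hα p.2.1 hpn hαC hchoose
      (fun L hL => (hω.2 L hL).1) (fun L hL => (hω.2 L hL).2) hω.1 i hi L (by omega)).trans ?_
    gcongr
    exact degreeConst_mono hj hjk (by omega)
  have hbad := (measureReal_union_le (μ := searchLaw n k j p) (A ×ˢ Set.univ)
    {ω | ω.2 ∈ N ω.1}).trans (add_le_add hbadA hbadN)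
  have hcompl := probReal_compl_eq_one_sub (μ := searchLaw n k j p)
    (MeasurableSet.of_discrete (s := A ×ˢ Set.univ ∪
      {ω : Ranking (SetOfSize n j) × Set (SetOfSize n k) | ω.2 ∈ N ω.1}))
  refine le_trans ?_ (measureReal_mono hgood (measure_ne_top _ _))
  rw [hcompl]
  have h3 : (small.card : ℝ) * e ≤ j * (n : ℝ) ^ j * e := by gcongr
  linarith

end SearchAlg

/-! ### Asymptotics -/

/-- `(1 - c / n) ^ m ≥ 1 / 2` for large `n`. -/
theorem pow_div_two_le_sub_pow {n c m : ℕ} (hn : 1 ≤ n) (h : 2 * (m * c) ≤ n) (hc : c ≤ n) :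
    (n : ℝ) ^ m / 2 ≤ ((n - c : ℕ) : ℝ) ^ m := by
  have hn' : (0 : ℝ) < n := by exact_mod_cast hn
  have hcn : (c : ℝ) / n ≤ 1 := by
    rw [div_le_one hn']
    exact_mod_cast hc
  have h1 := one_add_mul_le_pow (a := -((c : ℝ) / n)) (by linarith) m
  have h2 : (m : ℝ) * (c / n) ≤ 1 / 2 := by
    rw [mul_div_assoc', div_le_iff₀ hn']
    have : (2 * (m * c) : ℝ) ≤ n := by exact_mod_cast h
    linarith
  have h3 : ((n - c : ℕ) : ℝ) = n * (1 + -((c : ℝ) / n)) := by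
    rw [Nat.cast_sub hc]
    field_simp
    ring
  rw [h3, mul_pow, div_eq_mul_one_div]
  gcongr
  linarith

theorem pow_div_le_choose {n c m : ℕ} (hn : 1 ≤ n) (h : 2 * (m * (c + m)) ≤ n)
    (hc : c + m ≤ n) : (n : ℝ) ^ m / (2 * m.factorial) ≤ (n - c).choose m := by
  refine le_trans ?_ (Nat.pow_le_choose m (n - c))
  rw [← div_div]
  refine div_le_div_of_nonneg_right ?_ (Nat.cast_nonneg _)
  refine (pow_div_two_le_sub_pow hn h hc).trans ?_
  exact pow_le_pow_left₀ (Nat.cast_nonneg _) (Nat.cast_le.2 (by omega)) m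

theorem eventually_mul_pow_mul_exp_le (j : ℕ) {δ : ℝ} (hδ : 0 < δ) :
    ∀ᶠ n : ℕ in Filter.atTop, ∀ a : ℝ, 2 * (n : ℝ) ^ δ ≤ a →
      3 * (j * (n : ℝ) ^ j) * Real.exp (-a) ≤ Real.exp (-(n : ℝ) ^ (δ / 2)) := by
  have hlim : Filter.Tendsto (fun n : ℕ => (n : ℝ) ^ δ) Filter.atTop Filter.atTop :=
    (tendsto_rpow_atTop hδ).comp tendsto_natCast_atTop_atTop
  have h1 := (tendsto_rpow_mul_exp_neg_mul_atTop_nhds_zero (j / δ) 1 one_pos).comp hlim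
  have h2 := h1.const_mul (3 * (j : ℝ))
  rw [mul_zero] at h2
  filter_upwards [h2.eventually_le_const zero_lt_one, Filter.eventually_ge_atTop 1]
    with n hn hn1 a ha
  have hn1' : (1 : ℝ) ≤ n := by exact_mod_cast hn1
  have h3 : ((n : ℝ) ^ δ) ^ ((j : ℝ) / δ) = (n : ℝ) ^ j := by
    rw [← Real.rpow_mul (by positivity), mul_div_cancel₀ _ hδ.ne', Real.rpow_natCast]
  simp only [Function.comp_apply, h3, neg_mul, one_mul] at hn
  have h4 : (n : ℝ) ^ (δ / 2) ≤ (n : ℝ) ^ δ :=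
    Real.rpow_le_rpow_of_exponent_le hn1' (by linarith)
  calc _ ≤ 3 * (j * (n : ℝ) ^ j) * Real.exp (-(n : ℝ) ^ δ + -(n : ℝ) ^ (δ / 2)) := by
        gcongr
        linarith
    _ = 3 * j * ((n : ℝ) ^ j * Real.exp (-(n : ℝ) ^ δ)) * Real.exp (-(n : ℝ) ^ (δ / 2)) := by
        rw [Real.exp_add]
        ring
    _ ≤ 1 * Real.exp (-(n : ℝ) ^ (δ / 2)) := by gcongr
    _ = _ := one_mul _

theorem mainTheorem2 (k j : ℕ) (hj : 1 ≤ j) (hjk : j < k) :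
    ∃ C : ℝ, 0 < C ∧ ∃ ε₀ : ℝ, 0 < ε₀ ∧
      ∀ δ : ℝ, 0 < δ → δ < 1 →
      ∀ ε α : ℕ → ℝ,
        (∀ n, 0 < ε n ∧ ε n ≤ ε₀) →
        (∀ n, α n ≤ ε n / (32 * (k.factorial : ℝ) * 2 ^ j * C)) →
        Filter.Tendsto
          (fun n : ℕ => α n / ((n : ℝ) ^ (δ - 1) + (n : ℝ) ^ (-(j : ℝ) / 3)))
          Filter.atTop Filter.atTop →
        ∀ᶠ n : ℕ in Filter.atTop,
          ∃ p : unitInterval, (p : ℝ) = (1 + ε n) * pThreshold k j n ∧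
            ∀ (alg : SearchAlg) (σ : Ranking (SetOfSize n k))
              (ρ : Ranking (SetOfSize n j) → Ranking (SetOfSize n j)),
              1 - Real.exp (-(n : ℝ) ^ (δ / 2)) ≤
                (searchLaw n k j p).real
                  {ω | ∀ ℓ : ℕ, ℓ ≤ j - 1 → ∀ L : Finset (Fin n), L.card = ℓ →
                    (setDegree
                        (discoveredJSets alg σ ω.1 (ρ ω.1) ω.2 (α n * (n : ℝ) ^ k)) L : ℝ)
                      ≤ C * α n * (n : ℝ) ^ (j - ℓ)} := by
  have hs := slack_pos hj hjk
  have hs1 := slack_le hj hjk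
  have hB := one_le_numOther hj hjk
  have hC := one_le_degreeConst hj hjk j
  have hf : (1 : ℝ) ≤ (k - j).factorial := by exact_mod_cast Nat.factorial_pos _
  refine ⟨degreeConst k j j, by linarith, slack k j, hs, ?_⟩
  intro δ hδ _ ε α hε hα hlim
  filter_upwards [hlim.eventually_ge_atTop (2 / slack k j), eventually_mul_pow_mul_exp_le j hδ,
    Filter.eventually_ge_atTop (2 * (k - j).factorial),
    Filter.eventually_ge_atTop (2 * ((k - j) * (j + (k - j)))),
    Filter.eventually_ge_atTop (2 * (j * (0 + j))),
    Filter.eventually_ge_atTop k, Filter.eventually_ge_atTop 1] with n hK hexp hnf hnc hnc' hnk hn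
  have hn1 : (1 : ℝ) ≤ n := by exact_mod_cast hn
  have hn0 : (0 : ℝ) < n := by linarith
  obtain ⟨hε0, hε1⟩ := hε n
  -- the lower bound on `α`
  have hαn : 2 / slack k j * (n : ℝ) ^ δ ≤ α n * n := by
    rw [le_div_iff₀ (by positivity)] at hK
    have h1 : (n : ℝ) ^ δ = (n : ℝ) ^ (δ - 1) * n := by
      rw [← Real.rpow_add_one hn0.ne', sub_add_cancel]
    rw [h1, ← mul_assoc]
    refine mul_le_mul_of_nonneg_right (le_trans ?_ hK) hn0.le
    gcongr
    exact le_add_of_nonneg_right (by positivity)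
  have hδ1 : 1 ≤ (n : ℝ) ^ δ := Real.one_le_rpow hn1 hδ.le
  have hα2 : 2 ≤ α n * n := by
    refine le_trans ?_ hαn
    have h2 : 2 ≤ 2 / slack k j := by
      rw [le_div_iff₀ hs]
      linarith
    nlinarith
  have hsα : 2 * (n : ℝ) ^ δ ≤ slack k j * (α n * n) := by
    rw [div_mul_eq_mul_div, div_le_iff₀ hs] at hαn
    linarith
  have hpow : (n : ℝ) ^ ((j : ℝ) - (k : ℝ)) = ((n : ℝ) ^ (k - j))⁻¹ := by
    rw [← Real.rpow_natCast, ← Real.rpow_neg hn0.le, Nat.cast_sub hjk.le, neg_sub]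
  have hp : (1 + ε n) * pThreshold k j n =
      (1 + ε n) * ((k - j).factorial / numOther k j) / (n : ℝ) ^ (k - j) := by
    rw [pThreshold, hpow, numOther]
    ring
  have hp1 : (1 + ε n) * pThreshold k j n ≤ 1 := by
    rw [hp, div_le_one (by positivity)]
    calc _ ≤ 2 * ((k - j).factorial : ℝ) := by
          gcongr
          · linarith
          · exact div_le_self (by linarith) hB
      _ ≤ n := by exact_mod_cast hnf
      _ ≤ (n : ℝ) ^ (k - j) := le_self_pow₀ hn1 (by omega)
  have hp0 : 0 ≤ (1 + ε n) * pThreshold k j n := by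
    rw [hp]
    positivity
  refine ⟨⟨_, hp0, hp1⟩, rfl, fun alg σ ρ => ?_⟩
  have hpn : (1 + ε n) * pThreshold k j n * (n : ℝ) ^ (k - j) ≤
      (1 + slack k j) * ((k - j).factorial / numOther k j) := by
    rw [hp, div_mul_cancel₀ _ (by positivity)]
    gcongr
  have hαC : 2 ^ j * (degreeConst k j j * α n) ≤ 1 / (4 * (k - j).factorial) := by
    have h1 := hα n
    rw [le_div_iff₀ (by positivity)] at h1
    rw [le_div_iff₀ (by positivity)]
    have h2 : ((k - j).factorial : ℝ) ≤ k.factorial := by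
      exact_mod_cast Nat.factorial_le (Nat.sub_le k j)
    have h3 : 0 ≤ α n := by
      by_contra hcon
      nlinarith
    calc 2 ^ j * (degreeConst k j j * α n) * (4 * (k - j).factorial) ≤
          2 ^ j * (degreeConst k j j * α n) * (32 * k.factorial) := by
            gcongr
            norm_num
      _ = α n * (32 * (k.factorial : ℝ) * 2 ^ j * degreeConst k j j) := by ring
      _ ≤ 1 := by linarith
  refine le_trans ?_ (alg.real_degree_bound_ge σ hj hjk hn hα2 ⟨_, hp0, hp1⟩ hpn hαC
    (pow_div_le_choose hn hnc (by omega))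
    (by simpa using pow_div_le_choose (c := 0) hn hnc' (by omega)) ρ)
  linarith [hexp _ hsα]
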